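/- Let $(\mathscr A,\varphi)$ be a tracial $W^*$-probability space, that is, a von Neumann algebra $\mathscr A$ of operators on a complex Hilbert space with a unital, positive, faithful, tracial, normal (weakly continuous on bounded sets) linear functional $\varphi:\mathscr A\to\mathbb C$. Let $S=(S_t)_{t\ge 0}$ be a free Brownian motion in $\mathscr A$: the $S_t$ are self-adjoint, $S_0=0$, for $0\le s<t$ the increment $S_t-S_s$ has the centred semicircular law of variance $t-s$, with density $\frac{1}{2\pi (t-s)}\sqrt{4(t-s)-x^2}$ on $|x|\le 2\sqrt{t-s}$, and for $0\le t_0<t_1<\dots<t_m$ the increments $S_{t_1}-S_{t_0},\dots,S_{t_m}-S_{t_{m-1}}$ are freely independent. For $f\in L^2(\mathbb R_+^n)$ the Wigner integral $I_n^S(f)$ is defined as follows. If $f=\mathbf 1_{[a_1,b_1]\times\dots\times[a_n,b_n]}$ with pairwise disjoint intervals $[a_j,b_j]$, then $I^S_n(f)=(S_{b_1}-S_{a_1})\cdots(S_{b_n}-S_{a_n})$; this is extended linearly to the span of such indicators (off-diagonal step functions), and then by $L^2(\mathbb R_+^n)$-limits to all $f$, the limits on the operator side being taken in the norm $\|X\|_\varphi=\varphi(X^*X)^{1/2}$.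 For positive integers $n_1,\dots,n_r$ with $n=n_1+\dots+n_r$, let $n_1\otimes\dots\otimes n_r$ be the partition of $\{1,\dots,n\}$ into consecutive intervals of lengths $n_1,\dots,n_r$, and let $NC_2(n_1\otimes\dots\otimes n_r)$ be the set of pairings $\pi$ of $\{1,\dots,n\}$ (partitions all of whose blocks have two elements) that are noncrossing (there are no distinct blocks $B_1\ni x_1,y_1$ and $B_2\ni x_2,y_2$ of $\pi$ with $x_1<x_2<y_1<y_2$) and respect $n_1\otimes\dots\otimes n_r$ (no block of $\pi$ contains more than one element of any block of $n_1\otimes\dots\otimes n_r$). For a function $f$ on $\mathbb R_+^n$ the pairing integral is $$\int_\pi f=\int f(t_1,\dots,t_n)\prod_{\{i,j\}\in\pi}\delta(t_i-t_j)\,dt_1\cdots dt_n,$$ that is, the Lebesgue integral over $\mathbb R_+^{n/2}$ obtained by substituting one variable for each block of $\pi$. **Proposition.** Let $n_1,\dots,n_r$ be positive integers and $f_i\in L^2(\mathbb R_+^{n_i})$ for $1\le i\le r$. Then each Wigner integral $I_{n_i}^S(f_i)$ is a well-defined element of $\mathscr A$, the pairing integral $\int_\pi f_1\otimes\cdots\otimes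 f_r$ converges absolutely for every $\pi\in NC_2(n_1\otimes\cdots\otimes n_r)$, and $$\varphi\big[I_{n_1}^S(f_1)\cdots I_{n_r}^S(f_r)\big]=\sum_{\pi\in NC_2(n_1\otimes\cdots\otimes n_r)}\int_\pi f_1\otimes\cdots\otimes f_r .$$ -/

import Mathlib

open MeasureTheory Filter Topology
open scoped NNReal ENNReal

noncomputable section

/-- A tracial `W*`-probability space on a complex Hilbert space `H`: a von Neumann algebra of
operators on `H` together with a unital, positive, faithful, tracial, normal linear functional
`φ`. Normality is expressed as continuity of `φ` along norm-bounded weakly convergent families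
of operators in the algebra; in particular every functional that is continuous for the weak
operator topology is allowed. -/
structure WStarProbabilitySpace (H : Type*) [NormedAddCommGroup H] [InnerProductSpace ℂ H]
    [CompleteSpace H] where
  algebra : VonNeumannAlgebra H
  φ : algebra.toStarSubalgebra →ₗ[ℂ] ℂ
  unital : φ 1 = 1
  positive : ∀ X, 0 ≤ (φ (X * star X)).re ∧ (φ (X * star X)).im = 0
  faithful : ∀ X, φ (X * star X) = 0 → X = 0
  tracial : ∀ X Y, φ (X * Y) = φ (Y * X)
  normal : ∀ (R : ℝ) (l : Filter algebra.toStarSubalgebra) (X : algebra.toStarSubalgebra),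
    (∀ᶠ Y in l, ‖Y‖ ≤ R) →
    (∀ x y : H, Tendsto (fun Y : algebra.toStarSubalgebra => inner ℂ x ((Y : H →L[ℂ] H) y)) l
      (𝓝 (inner ℂ x ((X : H →L[ℂ] H) y)))) →
    Tendsto φ l (𝓝 (φ X))

section FreeProbability

variable {H : Type*} [NormedAddCommGroup H] [InnerProductSpace ℂ H] [CompleteSpace H]

/-- The algebra of elements of a `W*`-probability space. -/
abbrev WStarProbabilitySpace.Elem (P : WStarProbabilitySpace H) : Type _ :=
  P.algebra.toStarSubalgebra

/-- Free independence of a family of unital subalgebras: the expectation of a nonempty product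
of centred elements vanishes if neighbouring factors come from different subalgebras. -/
def AreFree (P : WStarProbabilitySpace H) {ι : Type*} (A : ι → Subalgebra ℂ P.Elem) : Prop :=
  ∀ (m : ℕ) (c : Fin m → ι) (X : Fin m → P.Elem), 0 < m →
    (∀ j, X j ∈ A (c j)) → (∀ j, P.φ (X j) = 0) →
    (∀ j k : Fin m, (j : ℕ) + 1 = (k : ℕ) → c j ≠ c k) →
    P.φ (List.ofFn X).prod = 0

/-- `μ` is the law of the random variable `X`: a probability measure on `ℝ` with the same
moments as `X`. -/
def IsLawOf (P : WStarProbabilitySpace H) (X : P.Elem) (μ : Measure ℝ) : Prop :=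
  IsProbabilityMeasure μ ∧ ∀ k : ℕ, Integrable (fun x : ℝ => x ^ k) μ ∧
    ((∫ x : ℝ, x ^ k ∂μ : ℝ) : ℂ) = P.φ (X ^ k)

/-- The centred semicircular distribution `S(0,v)` of variance `v > 0`. The real square root
vanishes for `x ^ 2 > 4 * v`, so that the density is supported in `|x| ≤ 2 √v`. -/
def semicircleLaw (v : ℝ) : Measure ℝ :=
  volume.withDensity fun x => ENNReal.ofReal (1 / (2 * Real.pi * v) * Real.sqrt (4 * v - x ^ 2))

/-- Free Brownian motion. -/
structure IsFreeBrownianMotion (P : WStarProbabilitySpace H) (S : ℝ≥0 → P.Elem) : Prop where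
  selfAdjoint : ∀ t, IsSelfAdjoint (S t)
  zero : S 0 = 0
  law : ∀ s t : ℝ≥0, s < t → IsLawOf P (S t - S s) (semicircleLaw ((t : ℝ) - (s : ℝ)))
  free : ∀ (m : ℕ) (t : Fin (m + 1) → ℝ≥0), StrictMono t →
    AreFree P fun i : Fin m => Algebra.adjoin ℂ {S (t i.succ) - S (t i.castSucc)}

/-- Lebesgue measure on `ℝ₊ = [0, ∞)`. -/
def lebesguePos : Measure ℝ≥0 := Measure.comap ((↑) : ℝ≥0 → ℝ) volume

/-- Lebesgue measure on `ℝ₊^ι`. -/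
abbrev lebesguePosPi (ι : Type*) [Fintype ι] : Measure (ι → ℝ≥0) :=
  Measure.pi fun _ : ι => lebesguePos

/-- The graph of the `n`-fold Wigner integral on off-diagonal step functions: the complex linear
span of the pairs consisting of the indicator of a box `[a₁,b₁] × ⋯ × [aₙ,bₙ]` with pairwise
disjoint sides and of the operator `(S_{b₁} - S_{a₁}) ⋯ (S_{bₙ} - S_{aₙ})`. -/
def wignerStepGraph (P : WStarProbabilitySpace H) (S : ℝ≥0 → P.Elem) (n : ℕ) :
    Submodule ℂ (((Fin n → ℝ≥0) → ℂ) × P.Elem) :=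
  Submodule.span ℂ {p | ∃ a b : Fin n → ℝ≥0, (∀ j, a j ≤ b j) ∧
    (∀ j k, j ≠ k → Disjoint (Set.Icc (a j) (b j)) (Set.Icc (a k) (b k))) ∧
    p.1 = Set.indicator (Set.univ.pi fun j => Set.Icc (a j) (b j)) (fun _ => (1 : ℂ)) ∧
    p.2 = (List.ofFn fun j => S (b j) - S (a j)).prod}

/-- `X` is the `n`-fold Wigner integral of `f`: it is the limit, in the norm
`‖Y‖² = φ (Y* Y)`, of the integrals of off-diagonal step functions that converge to `f`
in `L²(ℝ₊ⁿ)`. -/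
def IsWignerIntegral (P : WStarProbabilitySpace H) (S : ℝ≥0 → P.Elem) {n : ℕ}
    (f : (Fin n → ℝ≥0) → ℂ) (X : P.Elem) : Prop :=
  ∃ (g : ℕ → (Fin n → ℝ≥0) → ℂ) (Y : ℕ → P.Elem),
    (∀ k, (g k, Y k) ∈ wignerStepGraph P S n) ∧
    Tendsto (fun k => eLpNorm (g k - f) 2 (lebesguePosPi (Fin n))) atTop (𝓝 0) ∧
    Tendsto (fun k => P.φ (star (Y k - X) * (Y k - X))) atTop (𝓝 0)

open Classical in
/-- The Wigner integral `I_n^S(f)`, as an element of the algebra (and `0` if there is no such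
element). -/
def wignerIntegral (P : WStarProbabilitySpace H) (S : ℝ≥0 → P.Elem) {n : ℕ}
    (f : (Fin n → ℝ≥0) → ℂ) : P.Elem :=
  if h : ∃ X, IsWignerIntegral P S f X then h.choose else 0

end FreeProbability

/-- All blocks have size two. -/
def IsPairing {N : ℕ} (π : Finpartition (Finset.univ : Finset (Fin N))) : Prop :=
  ∀ B ∈ π.parts, B.card = 2

/-- Two distinct blocks cross. -/
def HasCrossing {N : ℕ} (π : Finpartition (Finset.univ : Finset (Fin N))) : Prop :=
  ∃ B₁ ∈ π.parts, ∃ B₂ ∈ π.parts, B₁ ≠ B₂ ∧ ∃ x₁ ∈ B₁, ∃ y₁ ∈ B₁, ∃ x₂ ∈ B₂, ∃ y₂ ∈ B₂,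
    x₁ < x₂ ∧ x₂ < y₁ ∧ y₁ < y₂

/-- The `i`-th block of consecutive elements in the interval partition `n₁ ⊗ ⋯ ⊗ n_r` of the
first `n₁ + ⋯ + n_r` integers. The equivalence `finSigmaFinEquiv` sends `(i, j)` to
`n₁ + ⋯ + n_{i-1} + j`. -/
def intervalBlock {r : ℕ} (n : Fin r → ℕ) (i : Fin r) : Finset (Fin (∑ i, n i)) :=
  Finset.univ.image fun j : Fin (n i) => finSigmaFinEquiv ⟨i, j⟩

/-- No block of `π` contains more than one element of any block of `n₁ ⊗ ⋯ ⊗ n_r`. -/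
def Respects {r : ℕ} (n : Fin r → ℕ)
    (π : Finpartition (Finset.univ : Finset (Fin (∑ i, n i)))) : Prop :=
  ∀ B ∈ π.parts, ∀ i, (B ∩ intervalBlock n i).card ≤ 1

open Classical in
/-- `NC₂(n₁ ⊗ ⋯ ⊗ n_r)`. -/
def respectfulNCPairings {r : ℕ} (n : Fin r → ℕ) :
    Finset (Finpartition (Finset.univ : Finset (Fin (∑ i, n i)))) :=
  Finset.univ.filter fun π => IsPairing π ∧ ¬ HasCrossing π ∧ Respects n π

/-- The tensor product `f₁ ⊗ ⋯ ⊗ f_r` on `ℝ₊^{n₁ + ⋯ + n_r}`. -/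
def tensorFun {r : ℕ} {n : Fin r → ℕ} (f : ∀ i, (Fin (n i) → ℝ≥0) → ℂ) :
    (Fin (∑ i, n i) → ℝ≥0) → ℂ :=
  fun t => ∏ i, f i fun j => t (finSigmaFinEquiv ⟨i, j⟩)

/-- Evaluation of a function on the diagonal set determined by `π`: there is one variable for
each block of `π`, substituted at all positions of that block. -/
def onBlocks {N : ℕ} (π : Finpartition (Finset.univ : Finset (Fin N)))
    (F : (Fin N → ℝ≥0) → ℂ) : (π.parts → ℝ≥0) → ℂ :=
  fun u => F fun k => u ⟨π.part k, π.part_mem.2 (Finset.mem_univ k)⟩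

/-- The pairing integral `∫_π F`, that is, the integral of `F` against
`∏_{{i,j} ∈ π} δ(tᵢ - tⱼ)`. -/
def pairingIntegral {N : ℕ} (π : Finpartition (Finset.univ : Finset (Fin N)))
    (F : (Fin N → ℝ≥0) → ℂ) : ℂ :=
  ∫ u, onBlocks π F u ∂(lebesguePosPi π.parts)

end

/-! The proof rests on a Wick calculus for finitely many free semicircular increments. The
orthogonal polynomials of the semicircular law are rescaled Chebyshev polynomials, so a nonconstant
one evaluated at an increment is centred. A Wick word in orthogonal letters splits into such
polynomials, one for each maximal run of equal letters. Freeness makes `φ` vanish on it, and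
multilinearity extends this to arbitrary combinations of increments (`map_wickWord_eq_zero`).

Multiplying a Wick word by one more letter either appends the letter or contracts it with the last
one. This is the rule by which a stack reads noncrossing pairings: a new point stays open, or closes
the most recently opened point. Hence moments of products are sums over noncrossing pairings
(`map_prod_eq_sum_ncPairings`). For off-diagonal boxes, pairings that join two variables of one
factor contribute zero, so only the respectful ones remain.

The passage to `L²` needs two estimates. Each block variable occurs in exactly two factors, so
iterated Cauchy-Schwarz bounds a pairing integral by the product of the `L²` norms
(`memLp_lintegral_prod_comp_le`); this also gives absolute convergence. There are at most `2 ^ N`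
noncrossing pairings of `N` points. Applied to the moments of `X* X`, where `X` is the integral of a
step function `g` in `n` variables, the formula gives `φ ((X* X) ^ m) ≤ (2 ^ n ‖g‖) ^ (2 * m)`.
Since `φ` is faithful, moment growth controls the operator norm, whence `‖X‖ ≤ 2 ^ n ‖g‖`
(`norm_le_of_mem_wignerStepLp`). Off-diagonal step functions are dense, so the integral extends to
`L²` with values in the algebra by operator-norm limits, and both sides of the moment formula are
continuous along these limits. -/

noncomputable section

/-! ### Chebyshev polynomials and the semicircular law. -/

/-- The monic orthogonal polynomials of the centred semicircular law of variance `v`. -/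
def semicirclePoly {R : Type*} [CommRing R] (v : R) : ℕ → Polynomial R
  | 0 => 1
  | 1 => Polynomial.X
  | k + 2 => Polynomial.X * semicirclePoly v (k + 1) - Polynomial.C v * semicirclePoly v k

lemma eval_semicirclePoly_sq (s y : ℝ) (k : ℕ) :
    (semicirclePoly (s ^ 2) k).eval (2 * s * y) =
      s ^ k * (Polynomial.Chebyshev.U ℝ k).eval y := by
  induction k using Nat.twoStepInduction with
  | zero => simp [semicirclePoly]
  | one => simp [semicirclePoly]; ring
  | more k h0 h1 =>
    push_cast at *
    rw [Polynomial.Chebyshev.U_add_two]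
    simp only [semicirclePoly, Polynomial.eval_sub, Polynomial.eval_mul, Polynomial.eval_X,
      Polynomial.eval_C, h0, h1, Polynomial.eval_ofNat]
    ring

/-- The weight `√(1 - y²)` is `(1 - y²)` times the arcsine weight, and `2 (1 - y²) U_k = T_k -
T_{k+2}`. Both `T` terms integrate to zero against the arcsine weight because their indices are
positive. -/
lemma integral_chebyshevU_mul_sqrt {k : ℕ} (hk : 0 < k) :
    ∫ y : ℝ, (Polynomial.Chebyshev.U ℝ k).eval y * √(1 - y ^ 2) = 0 := by
  have hcont (p : Polynomial ℝ) :
      Integrable (fun x => p.eval x) Polynomial.Chebyshev.measureT :=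
    Polynomial.Chebyshev.integrable_measureT p.continuous.continuousOn
  have key : ∫ y, ((1 - Polynomial.X ^ 2) * Polynomial.Chebyshev.U ℝ k).eval y
      ∂Polynomial.Chebyshev.measureT = 0 := by
    have h2 : (2 : Polynomial ℝ) * ((1 - Polynomial.X ^ 2) * Polynomial.Chebyshev.U ℝ k) =
        Polynomial.Chebyshev.T ℝ k - Polynomial.Chebyshev.T ℝ (k + 2) := by
      rw [Polynomial.Chebyshev.one_sub_X_sq_mul_U_eq_pol_in_T, Polynomial.Chebyshev.T_add_two]
      ring
    have h3 := congrArg (fun p : Polynomial ℝ => ∫ y, p.eval y ∂Polynomial.Chebyshev.measureT) h2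
    simp only [Polynomial.eval_sub] at h3
    rw [integral_sub (hcont _) (hcont _),
      Polynomial.Chebyshev.integral_eval_T_real_measureT_of_ne_zero (by omega),
      Polynomial.Chebyshev.integral_eval_T_real_measureT_of_ne_zero (by omega)] at h3
    simp only [Polynomial.eval_mul (p := 2), Polynomial.eval_ofNat, integral_const_mul] at h3
    linarith
  rw [Polynomial.Chebyshev.integral_measureT, intervalIntegral.integral_of_le (by norm_num)] at key
  rw [← setIntegral_eq_integral_of_forall_compl_eq_zero (s := Set.Ioc (-1) 1), ← key]
  · refine setIntegral_congr_fun measurableSet_Ioc fun y hy => ?_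
    have h0 : 0 ≤ 1 - y ^ 2 := by nlinarith [hy.1, hy.2]
    simp only [Polynomial.eval_mul, Polynomial.eval_sub, Polynomial.eval_one, Polynomial.eval_pow,
      Polynomial.eval_X]
    rcases h0.eq_or_lt with h | h
    · simp [← h]
    · have : √(1 - y ^ 2) ≠ 0 := (Real.sqrt_pos.2 h).ne'
      rw [Real.sqrt_inv]
      field_simp
      rw [Real.sq_sqrt h0]
  · intro y hy
    rw [Real.sqrt_eq_zero_of_nonpos, mul_zero]
    simp only [Set.mem_Ioc, not_and_or, not_lt, not_le] at hy
    rcases hy with h | h <;> nlinarith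

lemma integral_semicirclePoly {v : ℝ} (hv : 0 < v) {k : ℕ} (hk : 0 < k) :
    ∫ x, (semicirclePoly v k).eval x ∂(semicircleLaw v) = 0 := by
  obtain ⟨s, hs, rfl⟩ : ∃ s : ℝ, 0 < s ∧ v = s ^ 2 :=
    ⟨√v, Real.sqrt_pos.2 hv, (Real.sq_sqrt hv.le).symm⟩
  rw [semicircleLaw, integral_withDensity_eq_integral_toReal_smul (by fun_prop) (by simp)]
  have hnn (x : ℝ) : 0 ≤ 1 / (2 * Real.pi * s ^ 2) * √(4 * s ^ 2 - x ^ 2) := by positivity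
  simp only [ENNReal.toReal_ofReal (hnn _), smul_eq_mul]
  -- The substitution `x = 2 s y` carries the law of variance `s²` to the Chebyshev weight on `[-1,
  -- 1]`.
  have h := Measure.integral_comp_mul_left (fun x : ℝ =>
    1 / (2 * Real.pi * s ^ 2) * √(4 * s ^ 2 - x ^ 2) * (semicirclePoly (s ^ 2) k).eval x) (2 * s)
  have h2 : ∀ y : ℝ, √(4 * s ^ 2 - (2 * s * y) ^ 2) = 2 * s * √(1 - y ^ 2) := fun y => by
    rw [show 4 * s ^ 2 - (2 * s * y) ^ 2 = (2 * s) ^ 2 * (1 - y ^ 2) by ring,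
      Real.sqrt_mul (by positivity), Real.sqrt_sq (by positivity)]
  simp only [h2, eval_semicirclePoly_sq] at h
  have h3 : ∀ y : ℝ, 1 / (2 * Real.pi * s ^ 2) * (2 * s * √(1 - y ^ 2)) *
      (s ^ k * (Polynomial.Chebyshev.U ℝ k).eval y) = (1 / (2 * Real.pi * s ^ 2) * (2 * s) * s ^ k) *
      ((Polynomial.Chebyshev.U ℝ k).eval y * √(1 - y ^ 2)) := fun y => by ring
  simp only [h3, integral_const_mul, integral_chebyshevU_mul_sqrt hk, mul_zero] at h
  simpa [hs.ne'] using h.symm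

section FreeProbability

variable {H : Type*} [NormedAddCommGroup H] [InnerProductSpace ℂ H] [CompleteSpace H]

lemma IsLawOf.integral_eval {P : WStarProbabilitySpace H} {X : P.Elem} {μ : Measure ℝ}
    (h : IsLawOf P X μ) (p : Polynomial ℝ) :
    Integrable (fun x => p.eval x) μ ∧
      ((∫ x, p.eval x ∂μ : ℝ) : ℂ) = P.φ (Polynomial.aeval X (p.map (algebraMap ℝ ℂ))) := by
  induction p using Polynomial.induction_on' with
  | add p q hp hq =>
    simp only [Polynomial.eval_add]
    refine ⟨hp.1.add hq.1, ?_⟩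
    rw [integral_add hp.1 hq.1, Polynomial.map_add, map_add, map_add, ← hp.2, ← hq.2]
    push_cast; rfl
  | monomial k a =>
    simp only [Polynomial.eval_monomial]
    refine ⟨(h.2 k).1.const_mul a, ?_⟩
    rw [integral_const_mul, Polynomial.map_monomial, Polynomial.aeval_monomial, ← Algebra.smul_def,
      map_smul, ← (h.2 k).2]
    simp

lemma map_semicirclePoly (v : ℝ) (k : ℕ) :
    (semicirclePoly v k).map (algebraMap ℝ ℂ) = semicirclePoly (v : ℂ) k := by
  induction k using Nat.twoStepInduction with
  | zero => simp [semicirclePoly]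
  | one => simp [semicirclePoly]
  | more k h0 h1 => simp [semicirclePoly, h0, h1]

lemma IsFreeBrownianMotion.map_semicirclePoly {P : WStarProbabilitySpace H} {S : ℝ≥0 → P.Elem}
    (hS : IsFreeBrownianMotion P S) {s t : ℝ≥0} (hst : s < t) {k : ℕ} (hk : 0 < k) :
    P.φ (Polynomial.aeval (S t - S s) (semicirclePoly (((t : ℝ) - s : ℝ) : ℂ) k)) = 0 := by
  rw [← _root_.map_semicirclePoly, ← ((hS.law s t hst).integral_eval _).2,
    integral_semicirclePoly (sub_pos.2 (by exact_mod_cast hst)) hk, Complex.ofReal_zero]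

end FreeProbability

/-! ### Wick words and their vanishing expectation. -/

section WickWords

variable {A : Type*} [Ring A] [Algebra ℂ A]

/-- The Wick ordered product of the letters of a word, read from right to left, with respect to
the covariance `ip`. -/
def wickWord {β : Type*} (X : β → A) (ip : β → β → ℂ) : List β → A
  | [] => 1
  | [h] => X h
  | k :: j :: st => wickWord X ip (j :: st) * X k - ip j k • wickWord X ip st

lemma wickWord_cons_cons {β : Type*} (X : β → A) (ip : β → β → ℂ) (k j : β) (st : List β) :
    wickWord X ip (k :: j :: st) = wickWord X ip (j :: st) * X k - ip j k • wickWord X ip st := by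
  rw [wickWord]

/-- Linearity in one letter at an arbitrary position lets letters be expanded in a basis one at a
time. -/
lemma wickWord_linear {ι : Type*} [Fintype ι] (x : ι → A) (v : ι → ℂ) (w : List (ι → ℂ)) (u : List (ι → ℂ)) :
    ∃ Λ : (ι → ℂ) →ₗ[ℂ] A, ∀ h, wickWord (fun h : ι → ℂ => ∑ c, h c • x c)
      (fun g h => ∑ c, v c * g c * h c) (u ++ h :: w) = Λ h := by
  set X : (ι → ℂ) → A := fun h => ∑ c, h c • x c with hX
  set ip : (ι → ℂ) → (ι → ℂ) → ℂ := fun g h => ∑ c, v c * g c * h c with hip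
  let XL : (ι → ℂ) →ₗ[ℂ] A :=
    { toFun := X
      map_add' := fun g h => by simp [hX, add_smul, Finset.sum_add_distrib]
      map_smul' := fun a h => by simp [hX, mul_smul, Finset.smul_sum] }
  let ipl (g : ι → ℂ) : (ι → ℂ) →ₗ[ℂ] ℂ :=
    { toFun := fun h => ip g h
      map_add' := fun h h' => by simp [hip, mul_add, Finset.sum_add_distrib]
      map_smul' := fun a h => by
        simp only [hip, Pi.smul_apply, smul_eq_mul, RingHom.id_apply, Finset.mul_sum]
        exact Finset.sum_congr rfl fun c _ => by ring }
  have ip_comm (g h) : ip g h = ip h g := Finset.sum_congr rfl fun c _ => by ring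
  -- The Wick recursion refers to words shorter by one and by two letters.
  induction hl : u.length using Nat.strong_induction_on generalizing u with
  | _ l ih =>
    match u, hl with
    | [], _ =>
      cases w with
      | nil => exact ⟨XL, fun h => by simp [wickWord, XL]⟩
      | cons g w =>
        refine ⟨(LinearMap.mulLeft ℂ (wickWord X ip (g :: w))).comp XL -
          (ipl g).smulRight (wickWord X ip w), fun h => ?_⟩
        simp [wickWord_cons_cons, XL, ipl]
    | [g], hl =>
      obtain ⟨Λ, hΛ⟩ := ih 0 (by simp at hl; omega) [] rfl
      refine ⟨(LinearMap.mulRight ℂ (X g)).comp Λ -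
        (ipl g).smulRight (wickWord X ip w), fun h => ?_⟩
      have := hΛ h
      simp only [List.nil_append] at this
      simp [wickWord_cons_cons, this, ipl, ip_comm h g]
    | g :: g' :: u, hl =>
      obtain ⟨Λ, hΛ⟩ := ih (u.length + 1) (by simp at hl; omega) (g' :: u) rfl
      obtain ⟨Λ', hΛ'⟩ := ih u.length (by simp at hl; omega) u rfl
      refine ⟨(LinearMap.mulRight ℂ (X g)).comp Λ - ip g' g • Λ', fun h => ?_⟩
      have := hΛ h
      simp only [List.cons_append] at this
      simp [wickWord_cons_cons, this, hΛ' h]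

variable {ι : Type*} [DecidableEq ι]

/-- Within a run of equal letters the Wick recursion is the three-term recursion of
`semicirclePoly`. Where the run meets a different letter the covariance is zero, so the word
factorises there. -/
lemma wickWord_replicate_append (x : ι → A) (v : ι → ℂ) (c : ι) (w : List ι) (hw : c ∉ w.head?)
    (k : ℕ) :
    wickWord x (fun c d => if c = d then v c else 0) (List.replicate k c ++ w) =
      wickWord x (fun c d => if c = d then v c else 0) w *
        Polynomial.aeval (x c) (semicirclePoly (v c) k) := by
  induction k using Nat.twoStepInduction with
  | zero => simp [semicirclePoly]
  | one =>
    cases w with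
    | nil => simp [semicirclePoly, wickWord]
    | cons d w =>
      have hd : d ≠ c := by simpa using hw
      simp [semicirclePoly, wickWord_cons_cons, hd]
  | more k h0 h1 =>
    have h2 : List.replicate (k + 2) c ++ w = c :: c :: (List.replicate k c ++ w) := by
      simp [List.replicate_succ]
    have h3 : c :: (List.replicate k c ++ w) = List.replicate (k + 1) c ++ w := by
      simp [List.replicate_succ]
    rw [h2, wickWord_cons_cons, h0, h3, h1, semicirclePoly, mul_comm Polynomial.X]
    simp only [if_true, map_sub, map_mul, Polynomial.aeval_X, Polynomial.aeval_C, mul_sub,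
      mul_assoc, Algebra.smul_def]
    congr 1
    rw [← mul_assoc, Algebra.commutes, mul_assoc]

lemma List.exists_eq_replicate_append (c : ι) (w : List ι) :
    ∃ (k : ℕ) (u : List ι), w = List.replicate k c ++ u ∧ c ∉ u.head? := by
  induction w with
  | nil => exact ⟨0, [], by simp⟩
  | cons d w ih =>
    by_cases hd : d = c
    · obtain ⟨k, u, rfl, hu⟩ := ih
      exact ⟨k + 1, u, by simp [hd, List.replicate_succ], hu⟩
    · exact ⟨0, d :: w, by simp [hd]⟩

/-- Cutting the word into maximal runs gives an alternating product of centred elements, the form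
that freeness requires. Words are read from right to left, so the head of the word corresponds to
the last factor; recording this is what keeps the product alternating in the induction. -/
lemma exists_alternating_wickWord (φ : A →ₗ[ℂ] ℂ) (x : ι → A) (v : ι → ℂ)
    (hφ : ∀ c, ∀ k, 0 < k → φ (Polynomial.aeval (x c) (semicirclePoly (v c) k)) = 0)
    (w : List ι) :
    ∃ L : List (ι × A), (∀ p ∈ L, p.2 ∈ Algebra.adjoin ℂ {x p.1} ∧ φ p.2 = 0) ∧
      L.IsChain (fun p q => p.1 ≠ q.1) ∧
      (L.map Prod.snd).prod = wickWord x (fun c d => if c = d then v c else 0) w ∧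
      (∀ p ∈ L.getLast?, p.1 ∈ w.head?) ∧ (w ≠ [] → L ≠ []) := by
  induction hl : w.length using Nat.strong_induction_on generalizing w with
  | _ l ih =>
    cases w with
    | nil => exact ⟨[], by simp [wickWord]⟩
    | cons c w =>
      obtain ⟨k, u, rfl, hu⟩ := List.exists_eq_replicate_append c w
      obtain ⟨L, h1, h2, h3, h4, -⟩ := ih u.length (by simp at hl; omega) u rfl
      refine ⟨L ++ [(c, Polynomial.aeval (x c) (semicirclePoly (v c) (k + 1)))], ?_, ?_, ?_, ?_, ?_⟩
      · intro p hp
        simp only [List.mem_append, List.mem_singleton] at hp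
        rcases hp with hp | rfl
        · exact h1 p hp
        · exact ⟨Polynomial.aeval_mem_adjoin_singleton _ _, hφ c _ (Nat.succ_pos k)⟩
      · rw [List.isChain_append]
        refine ⟨h2, by simp, fun p hp q hq hpq => hu ?_⟩
        simp only [List.head?_cons, Option.mem_some_iff] at hq
        subst hq
        exact (show p.1 = c from hpq) ▸ h4 p hp
      · rw [← List.cons_append, ← List.replicate_succ, wickWord_replicate_append x v c u hu]
        simp [h3]
      · simp
      · simp

variable [Fintype ι]

lemma wickWord_map_single (x : ι → A) (v : ι → ℂ) (w : List ι) :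
    wickWord (fun h : ι → ℂ => ∑ c, h c • x c) (fun g h => ∑ c, v c * g c * h c)
      (w.map fun c => Pi.single c 1) = wickWord x (fun c d => if c = d then v c else 0) w := by
  have h1 (c : ι) : ∑ d, (Pi.single c (1 : ℂ) : ι → ℂ) d • x d = x c := by
    simp [Pi.single_apply]
  have h2 (c d : ι) : ∑ e, v e * (Pi.single c (1 : ℂ) : ι → ℂ) e * (Pi.single d (1 : ℂ) : ι → ℂ) e =
      if c = d then v c else 0 := by
    by_cases h : c = d <;> simp [Pi.single_apply, h, eq_comm]
  induction hl : w.length using Nat.strong_induction_on generalizing w with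
  | _ l ih =>
    match w, hl with
    | [], _ => simp [wickWord]
    | [c], _ => simp only [List.map_cons, List.map_nil, wickWord, h1]
    | c :: d :: w, hl =>
      have e1 := ih (w.length + 1) (by simp at hl; omega) (d :: w) rfl
      have e2 := ih w.length (by simp at hl; omega) w rfl
      simp only [List.map_cons] at e1 ⊢
      rw [wickWord_cons_cons, wickWord_cons_cons, e1, e2, h1, h2]

lemma map_wickWord_eq_zero (φ : A →ₗ[ℂ] ℂ) (x : ι → A) (v : ι → ℂ)
    (hφ : ∀ c, ∀ k, 0 < k → φ (Polynomial.aeval (x c) (semicirclePoly (v c) k)) = 0)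
    (hfree : ∀ L : List (ι × A), L ≠ [] →
      (∀ p ∈ L, p.2 ∈ Algebra.adjoin ℂ {x p.1} ∧ φ p.2 = 0) →
      L.IsChain (fun p q => p.1 ≠ q.1) → φ (L.map Prod.snd).prod = 0)
    (u : List (ι → ℂ)) (hu : u ≠ []) :
    φ (wickWord (fun h : ι → ℂ => ∑ c, h c • x c) (fun g h => ∑ c, v c * g c * h c) u) = 0 := by
  -- The word has a prefix `u` of arbitrary letters and a suffix `w` of basis letters. Expanding the
  -- last letter of `u` moves it into `w`, until only basis letters are left.
  suffices ∀ (u : List (ι → ℂ)) (w : List ι), u ++ w.map (fun c => Pi.single c 1) ≠ [] →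
      φ (wickWord (fun h : ι → ℂ => ∑ c, h c • x c) (fun g h => ∑ c, v c * g c * h c)
        (u ++ w.map fun c => Pi.single c 1)) = 0 by
    simpa using this u [] (by simpa using hu)
  intro u
  induction u using List.reverseRecOn with
  | nil =>
    intro w hw
    rw [List.nil_append, wickWord_map_single]
    obtain ⟨L, h1, h2, h3, -, h5⟩ := exists_alternating_wickWord φ x v hφ w
    rw [← h3]
    exact hfree L (h5 (by simpa using hw)) h1 h2
  | append_singleton u h ih =>
    intro w _
    obtain ⟨Λ, hΛ⟩ := wickWord_linear x v (w.map fun c => Pi.single c 1) u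
    rw [List.append_assoc, List.singleton_append, hΛ, pi_eq_sum_univ' h, map_sum, map_sum]
    refine Finset.sum_eq_zero fun c _ => ?_
    have := ih (c :: w) (by simp)
    rw [List.map_cons, hΛ] at this
    rw [map_smul, map_smul, this, smul_zero]

end WickWords

/-! ### Enumeration of noncrossing pairings by a stack. -/

section NoncrossingPairings

variable {α : Type*} [LinearOrder α]

/-- `p` is the set of blocks of a noncrossing pairing of `s`. -/
structure IsNCPairing (s : Finset α) (p : Finset (Finset α)) : Prop where
  card : ∀ B ∈ p, B.card = 2
  subset : ∀ B ∈ p, B ⊆ s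
  disjoint : ∀ B ∈ p, ∀ B' ∈ p, B ≠ B' → Disjoint B B'
  cover : ∀ x ∈ s, ∃ B ∈ p, x ∈ B
  noncrossing : ∀ B ∈ p, ∀ B' ∈ p, B ≠ B' → ∀ x ∈ B, ∀ y ∈ B, ∀ x' ∈ B', ∀ y' ∈ B',
    x < x' → x' < y → y < y' → False

open Classical in
/-- The noncrossing pairings of the elements of `st` and `rest` that have no block inside `st`. -/
def ncPairings (st rest : List α) : Finset (Finset (Finset α)) :=
  (st.toFinset ∪ rest.toFinset).powerset.powerset.filter fun p =>
    IsNCPairing (st.toFinset ∪ rest.toFinset) p ∧ ∀ B ∈ p, ¬ B ⊆ st.toFinset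

lemma mem_ncPairings {st rest : List α} {p : Finset (Finset α)} :
    p ∈ ncPairings st rest ↔
      IsNCPairing (st.toFinset ∪ rest.toFinset) p ∧ ∀ B ∈ p, ¬ B ⊆ st.toFinset := by
  classical
  simp only [ncPairings, Finset.mem_filter, Finset.mem_powerset, and_iff_right_iff_imp]
  exact fun h B hB => Finset.mem_powerset.2 (h.1.subset B hB)

lemma ncPairings_nil_nil : ncPairings ([] : List α) [] = {∅} := by
  ext p
  rw [mem_ncPairings, Finset.mem_singleton]
  constructor
  · rintro ⟨h, -⟩
    refine Finset.eq_empty_of_forall_notMem fun B hB => ?_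
    have := h.subset B hB
    have h2 := h.card B hB
    simp at this
    simp [this] at h2
  · rintro rfl
    exact ⟨⟨by simp, by simp, by simp, by simp, by simp⟩, by simp⟩

/-- Points of the stack `st` are open and must be closed by unread points, so a nonempty stack with
nothing left to read admits no pairing. -/
lemma ncPairings_cons_nil (j : α) (st : List α) : ncPairings (j :: st) [] = ∅ := by
  refine Finset.eq_empty_of_forall_notMem fun p hp => ?_
  rw [mem_ncPairings] at hp
  obtain ⟨B, hB, -⟩ := hp.1.cover j (by simp)
  exact hp.2 B hB (by simpa using hp.1.subset B hB)

lemma IsNCPairing.erase {s t : Finset α} {p : Finset (Finset α)} {j k : α}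
    (h : IsNCPairing s p) (hp : {j, k} ∈ p) (ht : ∀ x, x ∈ t ↔ x ∈ s ∧ x ≠ j ∧ x ≠ k) :
    IsNCPairing t (p.erase {j, k}) where
  card B hB := h.card B (Finset.mem_of_mem_erase hB)
  subset B hB x hx := by
    have hd := h.disjoint B (Finset.mem_of_mem_erase hB) _ hp (Finset.ne_of_mem_erase hB)
    have := Finset.disjoint_left.1 hd hx
    simp only [Finset.mem_insert, Finset.mem_singleton, not_or] at this
    exact (ht x).2 ⟨h.subset B (Finset.mem_of_mem_erase hB) hx, this⟩
  disjoint B hB B' hB' := h.disjoint B (Finset.mem_of_mem_erase hB) B' (Finset.mem_of_mem_erase hB')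
  cover x hx := by
    obtain ⟨hs, hj, hk⟩ := (ht x).1 hx
    obtain ⟨B, hB, hxB⟩ := h.cover x hs
    refine ⟨B, Finset.mem_erase.2 ⟨?_, hB⟩, hxB⟩
    rintro rfl
    simp [hj, hk] at hxB
  noncrossing B hB B' hB' :=
    h.noncrossing B (Finset.mem_of_mem_erase hB) B' (Finset.mem_of_mem_erase hB')

/-- A block whose endpoints have no other point between them cannot cross anything. -/
lemma IsNCPairing.insert {s t : Finset α} {p : Finset (Finset α)} {j k : α}
    (h : IsNCPairing t p) (hjk : j < k) (hj : j ∈ s) (hk : k ∈ s)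
    (ht : ∀ x, x ∈ t ↔ x ∈ s ∧ x ≠ j ∧ x ≠ k) (hbetween : ∀ x ∈ t, x < j ∨ k < x) :
    IsNCPairing s (insert {j, k} p) where
  card B hB := by
    rcases Finset.mem_insert.1 hB with rfl | hB
    · exact Finset.card_pair hjk.ne
    · exact h.card B hB
  subset B hB x hx := by
    rcases Finset.mem_insert.1 hB with rfl | hB
    · simp only [Finset.mem_insert, Finset.mem_singleton] at hx
      rcases hx with rfl | rfl <;> assumption
    · exact ((ht x).1 (h.subset B hB hx)).1
  disjoint B hB B' hB' hne := by
    have aux : ∀ B ∈ p, Disjoint {j, k} B := fun B hB => by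
      refine Finset.disjoint_right.2 fun x hx => ?_
      have := (ht x).1 (h.subset B hB hx)
      simp [this.2]
    rcases Finset.mem_insert.1 hB with rfl | hB <;> rcases Finset.mem_insert.1 hB' with rfl | hB'
    · exact absurd rfl hne
    · exact aux B' hB'
    · exact (aux B hB).symm
    · exact h.disjoint B hB B' hB' hne
  cover x hx := by
    by_cases hxt : x ∈ t
    · obtain ⟨B, hB, hxB⟩ := h.cover x hxt
      exact ⟨B, Finset.mem_insert_of_mem hB, hxB⟩
    · refine ⟨{j, k}, Finset.mem_insert_self _ _, ?_⟩
      rw [ht x] at hxt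
      simp only [Finset.mem_insert, Finset.mem_singleton]
      tauto
  noncrossing B hB B' hB' hne x hx y hy x' hx' y' hy' h1 h2 h3 := by
    rcases Finset.mem_insert.1 hB with rfl | hB <;> rcases Finset.mem_insert.1 hB' with rfl | hB'
    · exact absurd rfl hne
    · simp only [Finset.mem_insert, Finset.mem_singleton] at hx hy
      rcases hbetween x' (h.subset B' hB' hx') with hb | hb <;>
        rcases hx with rfl | rfl <;> rcases hy with rfl | rfl <;> order
    · simp only [Finset.mem_insert, Finset.mem_singleton] at hx' hy'
      rcases hbetween y (h.subset B hB hy) with hb | hb <;>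
        rcases hx' with rfl | rfl <;> rcases hy' with rfl | rfl <;> order
    · exact h.noncrossing B hB B' hB' hne x hx y hy x' hx' y' hy' h1 h2 h3

/-- A block inside `k :: st` but not inside `st` consists of `k` and the top of the stack. -/
lemma block_eq_pair {st rest : List α} {k : α} (hs : (st.reverse ++ k :: rest).Pairwise (· < ·))
    {p : Finset (Finset α)} (hp : p ∈ ncPairings st (k :: rest)) {B : Finset α} (hB : B ∈ p)
    (hBk : B ⊆ (k :: st).toFinset) : ∃ j, st.head? = some j ∧ B = {j, k} := by
  rw [mem_ncPairings] at hp
  obtain ⟨hp, hst⟩ := hp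
  simp only [List.pairwise_append, List.pairwise_reverse, List.pairwise_cons, List.mem_reverse,
    List.mem_cons, forall_eq_or_imp] at hs
  obtain ⟨hs1, ⟨hs2, -⟩, hs3⟩ := hs
  have hk : k ∈ B := by
    by_contra hk
    refine hst B hB fun x hx => ?_
    have := hBk hx
    simp only [List.toFinset_cons, Finset.mem_insert] at this
    rcases this with rfl | h
    · exact absurd hx hk
    · exact h
  obtain ⟨i, hi, rfl⟩ : ∃ i, i ≠ k ∧ B = {i, k} := by
    obtain ⟨a, b, hab, rfl⟩ := Finset.card_eq_two.1 (hp.card B hB)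
    simp only [Finset.mem_insert, Finset.mem_singleton] at hk
    rcases hk with rfl | rfl
    · exact ⟨b, hab.symm, Finset.pair_comm _ _⟩
    · exact ⟨a, hab, rfl⟩
  have hist : i ∈ st := by
    have : i ∈ (k :: st).toFinset := hBk (by simp)
    simpa [hi] using this
  cases st with
  | nil => simp at hist
  | cons j st =>
    refine ⟨j, rfl, ?_⟩
    by_cases hij : i = j
    · rw [hij]
    -- If `i` lies below the top `j`, then `j` can be paired neither inside the stack nor with `k`.
    -- Its partner `m` comes after `k`, and `i < j < k < m` is a crossing.
    exfalso
    have hist' : i ∈ st := by simpa [hij] using hist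
    have hij' : i < j := (List.pairwise_cons.1 hs1).1 i hist'
    obtain ⟨B', hB', hjB'⟩ := hp.cover j (by simp)
    have hjk : j < k := (hs3 j (by simp)).1
    have hne : ({i, k} : Finset α) ≠ B' := by
      rintro rfl
      simp only [Finset.mem_insert, Finset.mem_singleton] at hjB'
      rcases hjB' with rfl | rfl
      · exact hij rfl
      · exact absurd hjk (lt_irrefl _)
    have hd := hp.disjoint _ hB _ hB' hne
    have hns := hst B' hB'
    rw [Finset.not_subset] at hns
    obtain ⟨m, hm, hmst⟩ := hns
    have hmk : m ≠ k := by
      rintro rfl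
      exact Finset.disjoint_left.1 hd (by simp) hm
    have hmr : m ∈ rest := by
      have := hp.subset B' hB' hm
      simp only [Finset.mem_union, hmst, false_or, List.mem_toFinset, List.mem_cons, hmk] at this
      exact this
    exact hp.noncrossing _ hB _ hB' hne i (by simp) k (by simp) j hjB' m hm hij' hjk (hs2 m hmr)

lemma ncPairings_filter_eq {st rest : List α} {k : α} :
    (ncPairings st (k :: rest)).filter (fun p => ∀ B ∈ p, ¬ B ⊆ (k :: st).toFinset) =
      ncPairings (k :: st) rest := by
  ext p
  have hu : st.toFinset ∪ (k :: rest).toFinset = (k :: st).toFinset ∪ rest.toFinset := by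
    ext; simp
  rw [Finset.mem_filter, mem_ncPairings, mem_ncPairings, hu]
  constructor
  · rintro ⟨⟨h1, -⟩, h2⟩
    exact ⟨h1, h2⟩
  · rintro ⟨h1, h2⟩
    refine ⟨⟨h1, fun B hB h => h2 B hB (h.trans ?_)⟩, h2⟩
    simp

lemma sum_ncPairings_nil_cons {M : Type*} [AddCommMonoid M] {rest : List α} {k : α}
    (hs : (k :: rest).Pairwise (· < ·)) (F : Finset (Finset α) → M) :
    ∑ p ∈ ncPairings [] (k :: rest), F p = ∑ p ∈ ncPairings [k] rest, F p := by
  rw [← ncPairings_filter_eq, Finset.filter_true_of_mem]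
  intro p hp B hB hBk
  obtain ⟨j, hj, -⟩ := block_eq_pair (by simpa using hs) hp hB hBk
  simp at hj

lemma pair_notMem_of_mem_ncPairings {st rest : List α} {j k : α} {p : Finset (Finset α)}
    (hp : p ∈ ncPairings st rest) (hj : j ∉ st.toFinset ∪ rest.toFinset) : {j, k} ∉ p :=
  fun h => hj ((mem_ncPairings.1 hp).1.subset _ h (by simp))

lemma notMem_of_pairwise {st rest : List α} {j k : α}
    (hs : ((j :: st).reverse ++ k :: rest).Pairwise (· < ·)) :
    j ∉ st.toFinset ∪ rest.toFinset := by
  simp only [List.pairwise_append, List.pairwise_reverse, List.pairwise_cons, List.mem_reverse,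
    List.mem_cons, forall_eq_or_imp] at hs
  simp only [Finset.mem_union, List.mem_toFinset, not_or]
  exact ⟨fun h => lt_irrefl _ (hs.1.1 j h), fun h => lt_irrefl _ (hs.2.2.1.2 j h)⟩

/-- The next point `k` either stays open and is pushed, or closes a stack point, which by
`block_eq_pair` can only be the top `j`. Removing the block `{j, k}` is then a bijection onto the
pairings of the remaining points. -/
lemma sum_ncPairings_cons_cons {M : Type*} [AddCommMonoid M] {st rest : List α} {j k : α}
    (hs : ((j :: st).reverse ++ k :: rest).Pairwise (· < ·)) (F : Finset (Finset α) → M) :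
    ∑ p ∈ ncPairings (j :: st) (k :: rest), F p =
      ∑ p ∈ ncPairings (k :: j :: st) rest, F p +
        ∑ p ∈ ncPairings st rest, F (insert {j, k} p) := by
  rw [← ncPairings_filter_eq (st := j :: st), ← Finset.sum_filter_add_sum_filter_not _
    (fun p => ∀ B ∈ p, ¬ B ⊆ (k :: j :: st).toFinset)]
  congr 1
  have hnot := notMem_of_pairwise hs
  have hs' := hs
  simp only [List.pairwise_append, List.pairwise_reverse, List.pairwise_cons, List.mem_reverse,
    List.mem_cons, forall_eq_or_imp] at hs'
  obtain ⟨⟨hst, -⟩, ⟨hrest, -⟩, ⟨hjk, hjr⟩, hs4⟩ := hs'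
  have hmem (x : α) : x ∈ st.toFinset ∪ rest.toFinset ↔
      x ∈ (j :: st).toFinset ∪ (k :: rest).toFinset ∧ x ≠ j ∧ x ≠ k := by
    simp only [Finset.mem_union, List.mem_toFinset, List.mem_cons]
    constructor
    · rintro (h | h)
      · exact ⟨by tauto, (hst x h).ne, (hs4 x h).1.ne⟩
      · exact ⟨by tauto, (hjr x h).ne', (hrest x h).ne'⟩
    · tauto
  symm
  refine Finset.sum_bij' (fun p _ => insert {j, k} p) (fun p _ => p.erase {j, k}) ?_ ?_ ?_ ?_ ?_
  · intro p hp
    have hp' := mem_ncPairings.1 hp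
    rw [Finset.mem_filter, mem_ncPairings]
    refine ⟨⟨hp'.1.insert hjk (by simp) (by simp) hmem ?_, ?_⟩, ?_⟩
    · intro x hx
      simp only [Finset.mem_union, List.mem_toFinset] at hx
      exact hx.imp (hst x) (hrest x)
    · intro B hB hBs
      rcases Finset.mem_insert.1 hB with rfl | hB
      · have : k ∈ (j :: st).toFinset := hBs (by simp)
        simp only [List.toFinset_cons, Finset.mem_insert, List.mem_toFinset] at this
        rcases this with rfl | h
        · exact lt_irrefl _ hjk
        · exact lt_irrefl _ (hs4 k h).1
      · refine hp'.2 B hB fun x hx => ?_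
        have h1 := hBs hx
        have h2 := ((hmem x).1 (hp'.1.subset B hB hx)).2.1
        simpa [h2] using h1
    · push Not
      exact ⟨{j, k}, Finset.mem_insert_self _ _, by
        intro x; simp only [Finset.mem_insert, Finset.mem_singleton, List.toFinset_cons]; tauto⟩
  · intro p hp
    rw [Finset.mem_filter] at hp
    obtain ⟨hp, hB⟩ := hp
    push Not at hB
    obtain ⟨B, hB, hBk⟩ := hB
    obtain ⟨i, hi, rfl⟩ := block_eq_pair hs hp hB hBk
    obtain rfl : j = i := by simpa using hi
    rw [mem_ncPairings] at hp ⊢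
    refine ⟨hp.1.erase hB hmem, fun B hB h => hp.2 B (Finset.mem_of_mem_erase hB) (h.trans ?_)⟩
    simp
  · intro p hp
    exact Finset.erase_insert (pair_notMem_of_mem_ncPairings hp hnot)
  · intro p hp
    rw [Finset.mem_filter] at hp
    obtain ⟨hp, hB⟩ := hp
    push Not at hB
    obtain ⟨B, hB, hBk⟩ := hB
    obtain ⟨i, hi, rfl⟩ := block_eq_pair hs hp hB hBk
    obtain rfl : j = i := by simpa using hi
    exact Finset.insert_erase hB
  · intro p hp
    rfl

/-- Each unread point offers at most two choices, push or close. -/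
lemma card_ncPairings_le (st rest : List α) (hs : (st.reverse ++ rest).Pairwise (· < ·)) :
    (ncPairings st rest).card ≤ 2 ^ rest.length := by
  induction rest generalizing st with
  | nil =>
    cases st with
    | nil => simp [ncPairings_nil_nil]
    | cons j st => simp [ncPairings_cons_nil]
  | cons k rest ih =>
    cases st with
    | nil =>
      rw [Finset.card_eq_sum_ones, sum_ncPairings_nil_cons (by simpa using hs),
        ← Finset.card_eq_sum_ones, List.length_cons, pow_succ]
      have := ih [k] (by simpa using hs)
      omega
    | cons j st =>
      rw [Finset.card_eq_sum_ones, sum_ncPairings_cons_cons hs, ← Finset.card_eq_sum_ones,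
        ← Finset.card_eq_sum_ones, List.length_cons, pow_succ]
      have h1 := ih (k :: j :: st) (by simpa using hs)
      have h2 := ih st (by
        refine hs.sublist ?_
        simp)
      omega

/-- The stack recursion with its boundary values determines a function of stack and unread word; the
weighted sum over pairings is its solution. -/
lemma sum_ncPairings_of_recursion (w : Finset α → ℂ) (W : List α → List α → ℂ)
    (h0 : W [] [] = 1) (h1 : ∀ j st, W (j :: st) [] = 0)
    (h2 : ∀ k rest, W [] (k :: rest) = W [k] rest)
    (h3 : ∀ j st k rest, j ≠ k → W (j :: st) (k :: rest) =
      W (k :: j :: st) rest + w {j, k} * W st rest)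
    (st rest : List α) (hs : (st.reverse ++ rest).Pairwise (· < ·)) :
    W st rest = ∑ p ∈ ncPairings st rest, ∏ B ∈ p, w B := by
  induction rest generalizing st with
  | nil =>
    cases st with
    | nil => simp [ncPairings_nil_nil, h0]
    | cons j st => simp [ncPairings_cons_nil, h1]
  | cons k rest ih =>
    cases st with
    | nil =>
      rw [sum_ncPairings_nil_cons (by simpa using hs), h2, ih [k] (by simpa using hs)]
    | cons j st =>
      have hjk : j < k := by
        simp only [List.pairwise_append, List.mem_reverse, List.mem_cons] at hs
        exact hs.2.2 j (by simp) k (by simp)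
      rw [sum_ncPairings_cons_cons hs, h3 _ _ _ _ hjk.ne, ih _ (by simpa using hs),
        ih st (hs.sublist (by simp)), Finset.mul_sum]
      congr 1
      refine Finset.sum_congr rfl fun p hp => ?_
      rw [Finset.prod_insert (pair_notMem_of_mem_ncPairings hp (notMem_of_pairwise hs))]

end NoncrossingPairings

/-! ### The Wick formula for products of increments. -/

lemma map_prod_eq_sum_ncPairings {A : Type*} [Ring A] [Algebra ℂ A] {ι : Type*} [DecidableEq ι]
    [Fintype ι] (φ : A →ₗ[ℂ] ℂ) (hone : φ 1 = 1) (x : ι → A) (v : ι → ℂ)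
    (hφ : ∀ c, ∀ k, 0 < k → φ (Polynomial.aeval (x c) (semicirclePoly (v c) k)) = 0)
    (hfree : ∀ L : List (ι × A), L ≠ [] →
      (∀ p ∈ L, p.2 ∈ Algebra.adjoin ℂ {x p.1} ∧ φ p.2 = 0) →
      L.IsChain (fun p q => p.1 ≠ q.1) → φ (L.map Prod.snd).prod = 0)
    {α : Type*} [LinearOrder α] (h : α → ι → ℂ) (w : Finset α → ℂ)
    (hw : ∀ j k, j ≠ k → w {j, k} = ∑ c, v c * h j c * h k c)
    (l : List α) (hl : l.Pairwise (· < ·)) :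
    φ (l.map fun k => ∑ c, h k c • x c).prod = ∑ p ∈ ncPairings [] l, ∏ B ∈ p, w B := by
  set X : (ι → ℂ) → A := fun h => ∑ c, h c • x c with hX
  set ip : (ι → ℂ) → (ι → ℂ) → ℂ := fun g h => ∑ c, v c * g c * h c with hip
  -- The stack becomes a Wick word and the unread points an ordinary product. The push-or-close rule
  -- is then the Wick recursion solved for the product of a word and a letter.
  have := sum_ncPairings_of_recursion w
    (fun st rest => φ (wickWord X ip (st.map h) * (rest.map fun k => X (h k)).prod))
    (by simp [wickWord, hone])
    (fun j st => by
      simpa using map_wickWord_eq_zero φ x v hφ hfree ((j :: st).map h) (by simp))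
    (fun k rest => by simp [wickWord])
    (fun j st k rest hjk => by
      simp only [List.map_cons, List.prod_cons, wickWord_cons_cons, sub_mul, map_sub, hw j k hjk,
        smul_mul_assoc, map_smul, smul_eq_mul, mul_assoc]
      simp [hip, mul_assoc])
    [] l (by simpa using hl)
  rw [← this]
  simp [wickWord, hX]

/-- The maximum makes the right side zero when `q < p`, where the sum is empty; thus disjoint
intervals need no separate treatment. -/
lemma sum_ite_fin_telescope {G : Type*} [AddCommGroup G] {M : ℕ} (f : Fin (M + 1) → G)
    (p q : Fin (M + 1)) :
    (∑ c : Fin M, if p ≤ c.castSucc ∧ c.succ ≤ q then f c.succ - f c.castSucc else 0) =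
      f (max p q) - f p := by
  induction q using Fin.induction with
  | zero => simp [Fin.succ_ne_zero]
  | succ i ih =>
    have hc : ∀ c : Fin M, (if p ≤ c.castSucc ∧ c.succ ≤ i.succ then f c.succ - f c.castSucc
        else 0) = (if p ≤ c.castSucc ∧ c.succ ≤ i.castSucc then f c.succ - f c.castSucc else 0) +
        if c = i then (if p ≤ i.castSucc then f i.succ - f i.castSucc else 0) else 0 := by
      intro c
      rcases lt_trichotomy c i with h | rfl | h
      · have h1 : c.succ ≤ i.castSucc := h
        have h2 : c.succ ≤ i.succ := by simpa using h.le
        simp [h1, h2, h.ne]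
      · have h1 : ¬ c.succ ≤ c.castSucc := by simp [Fin.le_def]
        simp [h1]
      · have h1 : ¬ c.succ ≤ i.castSucc := fun h' => absurd (show (c : ℕ) + 1 ≤ i from h') (by have : (i : ℕ) < c := h; omega)
        have h2 : ¬ c.succ ≤ i.succ := by simpa using h
        simp [h1, h2, h.ne']
    rw [Finset.sum_congr rfl fun c _ => hc c, Finset.sum_add_distrib, ih, Finset.sum_ite_eq' _ i]
    simp only [Finset.mem_univ, if_true]
    by_cases hp : p ≤ i.castSucc
    · have hp' : p ≤ i.succ := hp.trans (Fin.castSucc_le_succ i)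
      rw [if_pos hp, max_eq_right hp, max_eq_right hp']
      abel
    · have h1 : i.succ ≤ p := Fin.castSucc_lt_iff_succ_le.1 (not_le.1 hp)
      rw [if_neg hp, max_eq_left (not_le.1 hp).le, max_eq_left h1, add_zero]

lemma exists_strictMono_grid (T : Finset ℝ≥0) :
    ∃ (M : ℕ) (t : Fin (M + 1) → ℝ≥0), StrictMono t ∧ ∀ x ∈ T, x ∈ Set.range t := by
  obtain ⟨M, hM⟩ : ∃ M, (insert 0 T).card = M + 1 :=
    Nat.exists_eq_succ_of_ne_zero (Finset.card_pos.2 ⟨0, Finset.mem_insert_self 0 T⟩).ne'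
  refine ⟨M, (insert 0 T).orderEmbOfFin hM, OrderEmbedding.strictMono _, fun x hx => ?_⟩
  rw [Finset.range_orderEmbOfFin]
  simp [hx]

lemma measurableEmbedding_nnreal_coe : MeasurableEmbedding ((↑) : ℝ≥0 → ℝ) :=
  MeasurableEmbedding.subtype_coe measurableSet_Ici

lemma lebesguePos_Icc (a b : ℝ≥0) : lebesguePos (Set.Icc a b) = ENNReal.ofReal ((b : ℝ) - a) := by
  rw [lebesguePos, measurableEmbedding_nnreal_coe.comap_apply, ← Real.volume_Icc]
  congr 1
  ext x
  simp only [Set.mem_image, Set.mem_Icc]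
  constructor
  · rintro ⟨y, hy, rfl⟩
    exact_mod_cast hy
  · intro hx
    exact ⟨⟨x, a.2.trans hx.1⟩, by exact_mod_cast hx, rfl⟩

instance : SigmaFinite lebesguePos := by
  refine ⟨⟨⟨fun n => Set.Icc 0 n, fun _ => trivial, fun n => ?_, ?_⟩⟩⟩
  · rw [lebesguePos_Icc]; exact ENNReal.ofReal_lt_top
  · refine Set.eq_univ_of_forall fun x => Set.mem_iUnion.2 ?_
    obtain ⟨n, hn⟩ := exists_nat_ge x
    exact ⟨n, zero_le, hn⟩

lemma lebesguePos_singleton (a : ℝ≥0) : lebesguePos {a} = 0 := by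
  rw [← Set.Icc_self, lebesguePos_Icc]; simp

/-- Both sides are the length of the intersection of two intervals, the right one counted by grid
cells. This identifies the covariance of two increments with a block integral. -/
lemma integral_prod_indicator_Icc_pair {α : Type*} [DecidableEq α] {M : ℕ} (t : Fin (M + 1) → ℝ≥0)
    (ht : StrictMono t) (a b : α → Fin (M + 1)) {j k : α} (hjk : j ≠ k) :
    ∫ x, ∏ l ∈ {j, k}, (Set.Icc (t (a l)) (t (b l))).indicator (fun _ => (1 : ℂ)) x ∂lebesguePos =
      ∑ c : Fin M, (((t c.succ : ℝ) - t c.castSucc : ℝ) : ℂ) *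
        (if a j ≤ c.castSucc ∧ c.succ ≤ b j then 1 else 0) *
        (if a k ≤ c.castSucc ∧ c.succ ≤ b k then 1 else 0) := by
  have h1 : ∀ c : Fin M, (((t c.succ : ℝ) - t c.castSucc : ℝ) : ℂ) *
        (if a j ≤ c.castSucc ∧ c.succ ≤ b j then 1 else 0) *
        (if a k ≤ c.castSucc ∧ c.succ ≤ b k then 1 else 0) =
      if max (a j) (a k) ≤ c.castSucc ∧ c.succ ≤ min (b j) (b k) then
        (((t c.succ : ℝ) : ℂ) - ((t c.castSucc : ℝ) : ℂ)) else 0 := by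
    intro c
    simp only [max_le_iff, le_min_iff]
    split_ifs <;> simp_all
  rw [Finset.sum_congr rfl fun c _ => h1 c,
    sum_ite_fin_telescope (fun i => ((t i : ℝ) : ℂ)) _ _]
  have h2 : ∀ x, ∏ l ∈ {j, k}, (Set.Icc (t (a l)) (t (b l))).indicator (fun _ => (1 : ℂ)) x =
      (Set.Icc (t (max (a j) (a k))) (t (min (b j) (b k)))).indicator (fun _ => (1 : ℂ)) x := by
    intro x
    rw [Finset.prod_pair hjk, ht.monotone.map_max, ht.monotone.map_min, ← Set.Icc_inter_Icc,
      ← Set.inter_indicator_mul]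
    simp
  simp only [h2]
  rw [integral_indicator measurableSet_Icc, setIntegral_const, Measure.real, lebesguePos_Icc]
  rcases le_total (max (a j) (a k)) (min (b j) (b k)) with h | h
  · rw [max_eq_right h, ENNReal.toReal_ofReal (sub_nonneg.2 (by exact_mod_cast ht.monotone h))]
    simp
  · rw [max_eq_left h, ENNReal.ofReal_of_nonpos (sub_nonpos.2 (by exact_mod_cast ht.monotone h))]
    simp

section FreeProbability

variable {H : Type*} [NormedAddCommGroup H] [InnerProductSpace ℂ H] [CompleteSpace H]

lemma AreFree.map_list_prod {P : WStarProbabilitySpace H} {ι : Type*}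
    {A : ι → Subalgebra ℂ P.Elem} (h : AreFree P A) (L : List (ι × P.Elem)) (hL : L ≠ [])
    (hA : ∀ p ∈ L, p.2 ∈ A p.1 ∧ P.φ p.2 = 0) (hc : L.IsChain (fun p q => p.1 ≠ q.1)) :
    P.φ (L.map Prod.snd).prod = 0 := by
  have := h L.length (fun j => L[j].1) (fun j => L[j].2) (List.length_pos_iff.2 hL)
    (fun j => (hA _ (L.getElem_mem _)).1) (fun j => (hA _ (L.getElem_mem _)).2)
    (fun j k hjk => by
      have h1 := List.isChain_iff_getElem.1 hc j (by omega)
      simpa [hjk] using h1)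
  simpa [List.ofFn_getElem_eq_map L Prod.snd] using this

/-- On a common grid containing all endpoints, every increment is a sum of free increments over the
cells. The intervals may overlap. -/
lemma IsFreeBrownianMotion.map_prod_increments {P : WStarProbabilitySpace H} {S : ℝ≥0 → P.Elem}
    (hS : IsFreeBrownianMotion P S) {N : ℕ} (a b : Fin N → ℝ≥0) (hab : ∀ j, a j ≤ b j) :
    P.φ (List.ofFn fun k => S (b k) - S (a k)).prod =
      ∑ p ∈ ncPairings [] (List.finRange N), ∏ B ∈ p,
        ∫ x, ∏ k ∈ B, (Set.Icc (a k) (b k)).indicator (fun _ => (1 : ℂ)) x ∂lebesguePos := by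
  classical
  obtain ⟨M, t, ht, hT⟩ := exists_strictMono_grid (Finset.univ.image a ∪ Finset.univ.image b)
  choose a' ha' using fun k => hT (a k) (by simp)
  choose b' hb' using fun k => hT (b k) (by simp)
  have hab' : ∀ k, a' k ≤ b' k := fun k => ht.le_iff_le.1 (by rw [ha', hb']; exact hab k)
  have key := map_prod_eq_sum_ncPairings P.φ P.unital
    (fun c : Fin M => S (t c.succ) - S (t c.castSucc))
    (fun c => (((t c.succ : ℝ) - t c.castSucc : ℝ) : ℂ))
    (fun c k hk => hS.map_semicirclePoly (ht (Fin.castSucc_lt_succ)) hk)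
    (fun L hL hA hc => (hS.free M t ht).map_list_prod L hL hA hc)
    (fun k c => if a' k ≤ c.castSucc ∧ c.succ ≤ b' k then 1 else 0)
    (fun B => ∫ x, ∏ k ∈ B, (Set.Icc (a k) (b k)).indicator (fun _ => (1 : ℂ)) x ∂lebesguePos)
    (fun j k hjk => by
      simp only [← ha', ← hb']
      exact integral_prod_indicator_Icc_pair t ht a' b' hjk)
    (List.finRange N) (List.pairwise_lt_finRange N)
  rw [← key, List.ofFn_eq_map]
  congr 3
  funext k
  simp only [ite_smul, one_smul, zero_smul]
  rw [sum_ite_fin_telescope (fun i => S (t i)), max_eq_right (hab' k), ha', hb']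

end FreeProbability

/-! ### Pairing integrals of square integrable functions. -/

section Contraction

/-- Cauchy-Schwarz for a product of functions of finitely many variables in which every
integrated variable occurs in exactly two factors. -/
lemma lmarginal_prod_le {K ι : Type*} [DecidableEq K] [Fintype ι] {Y : K → Type*}
    [∀ k, MeasurableSpace (Y k)] (μ : ∀ k, Measure (Y k)) [∀ k, SigmaFinite (μ k)]
    (A : ι → Finset K) (F : ι → (∀ k, Y k) → ℝ≥0∞) (hF : ∀ i, Measurable (F i))
    (hdep : ∀ i x y, (∀ k ∈ A i, x k = y k) → F i x = F i y) (s : Finset K)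
    (hs : ∀ k ∈ s, (Finset.univ.filter fun i => k ∈ A i).card = 2) (x : ∀ k, Y k) :
    (∫⋯∫⁻_s, (fun u => ∏ i, F i u) ∂μ) x ≤
      ∏ i, ((∫⋯∫⁻_s ∩ A i, (fun u => F i u ^ (2 : ℝ)) ∂μ) x) ^ (1 / 2 : ℝ) := by
  induction s using Finset.induction_on generalizing x with
  | empty =>
    simp only [Finset.empty_inter, lmarginal_empty, ← ENNReal.rpow_mul]
    norm_num
  | insert k s hk ih =>
    have hm : ∀ i, Measurable fun u => F i u ^ (2 : ℝ) := fun i => (hF i).pow_const _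
    rw [lmarginal_insert _ (Finset.measurable_fun_prod _ fun i _ => hF i) hk]
    set G : ι → (∀ k, Y k) → ℝ≥0∞ := fun i => ∫⋯∫⁻_s ∩ A i, (fun u => F i u ^ (2 : ℝ)) ∂μ with hG
    have hGm : ∀ i, Measurable (G i) := fun i => (hm i).lmarginal μ
    have hup : ∀ i, Measurable fun y => G i (Function.update x k y) := fun i =>
      (hGm i).comp (measurable_update x)
    have hout : ∀ i, k ∉ A i → ∀ y, G i (Function.update x k y) = G i x := fun i hi y => by
      rw [hG]
      dsimp only
      rw [lmarginal_update_of_notMem (hm i) (by simp [hk])]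
      congr 1
      funext z
      dsimp only [Function.comp_apply]
      rw [hdep i (Function.update z k y) z fun l hl => Function.update_of_ne (by
        rintro rfl; exact hi hl) _ _]
    calc ∫⁻ y, (∫⋯∫⁻_s, (fun u => ∏ i, F i u) ∂μ) (Function.update x k y) ∂μ k
        ≤ ∫⁻ y, ∏ i, G i (Function.update x k y) ^ (1 / 2 : ℝ) ∂μ k :=
          lintegral_mono fun y => ih (fun l hl => hs l (Finset.mem_insert_of_mem hl)) _
      _ = (∏ i with k ∉ A i, G i x ^ (1 / 2 : ℝ)) *
            ∫⁻ y, ∏ i with k ∈ A i, G i (Function.update x k y) ^ (1 / 2 : ℝ) ∂μ k := by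
          rw [← lintegral_const_mul _ (Finset.measurable_fun_prod _ fun i _ => (hup i).pow_const _)]
          congr 1
          funext y
          rw [← Finset.prod_filter_mul_prod_filter_not Finset.univ (fun i => k ∈ A i), mul_comm]
          congr 1
          exact Finset.prod_congr rfl fun i hi => by rw [hout i (Finset.mem_filter.1 hi).2]
      _ ≤ (∏ i with k ∉ A i, G i x ^ (1 / 2 : ℝ)) *
            ∏ i with k ∈ A i, (∫⁻ y, G i (Function.update x k y) ∂μ k) ^ (1 / 2 : ℝ) := by
          gcongr
          -- Exactly two factors depend on the variable `k`, so the exponents `1 / 2` add up to one,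
          -- as Hölder's inequality requires.
          refine ENNReal.lintegral_prod_norm_pow_le _ (fun i _ => (hup i).aemeasurable) ?_
            (fun i _ => by norm_num)
          rw [Finset.sum_const, hs k (Finset.mem_insert_self k s)]
          norm_num
      _ = _ := by
          rw [← Finset.prod_filter_mul_prod_filter_not Finset.univ (fun i => k ∈ A i), mul_comm]
          congr 1
          · refine Finset.prod_congr rfl fun i hi => ?_
            rw [Finset.insert_inter_of_mem (Finset.mem_filter.1 hi).2,
              lmarginal_insert _ (hm i) (by simp [hk])]
          · refine Finset.prod_congr rfl fun i hi => ?_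
            rw [Finset.insert_inter_of_notMem (Finset.mem_filter.1 hi).2]

variable {K ι : Type*} [Fintype K] {Y : Type*} [MeasurableSpace Y] {μ : Measure Y}
  [SigmaFinite μ]

/-- For infinite `μ` the projection `u ↦ u ∘ e` does not preserve measure, but integrating over the
coordinates in the range of `e` alone shows that null functions pull back to null functions. -/
lemma lintegral_comp_injective_eq_zero {T : Type*} [Fintype T] {e : T → K}
    (he : Function.Injective e) {f : (T → Y) → ℝ≥0∞} (hf : Measurable f)
    (h0 : ∫⁻ t, f t ∂(Measure.pi fun _ => μ) = 0) :
    ∫⁻ u, f (u ∘ e) ∂(Measure.pi fun _ : K => μ) = 0 := by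
  classical
  rw [← lintegral_zero (α := K → Y) (μ := Measure.pi fun _ : K => μ)]
  refine lintegral_eq_of_lmarginal_eq (Finset.univ.image e)
    (hf.comp (measurable_pi_lambda _ fun i => measurable_pi_apply _)) measurable_zero ?_
  funext x
  have := lmarginal_image (μ := fun _ : K => μ) he Finset.univ hf x
  refine this.trans ?_
  rw [lmarginal_univ]
  refine h0.trans ?_
  simp [lmarginal]

lemma ae_comp_injective {T : Type*} [Fintype T] {e : T → K} (he : Function.Injective e)
    {p : (T → Y) → Prop} (hp : ∀ᵐ t ∂(Measure.pi fun _ => μ), p t) :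
    ∀ᵐ u ∂(Measure.pi fun _ : K => μ), p (u ∘ e) := by
  have hme : Measurable fun u : K → Y => u ∘ e :=
    measurable_pi_lambda _ fun i => measurable_pi_apply _
  set N := toMeasurable (Measure.pi fun _ : T => μ) {t | ¬ p t}
  have hN : MeasurableSet N := measurableSet_toMeasurable _ _
  have hN0 : (Measure.pi fun _ : T => μ) N = 0 := by rw [measure_toMeasurable]; exact hp
  have h := lintegral_comp_injective_eq_zero (μ := μ) he (f := N.indicator 1)
    (measurable_one.indicator hN) (by rw [lintegral_indicator_one hN, hN0])
  have h2 : (fun u : K → Y => N.indicator (1 : (T → Y) → ℝ≥0∞) (u ∘ e)) =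
      ((fun u : K → Y => u ∘ e) ⁻¹' N).indicator 1 := by
    funext u; rfl
  rw [h2, lintegral_indicator_one (hme hN)] at h
  refine measure_mono_null (fun u hu => ?_) h
  exact subset_toMeasurable _ _ hu

variable [Fintype ι] {T : ι → Type*} [∀ i, Fintype (T i)] (e : ∀ i, T i → K)

/-- Here `e i` says which integration variable is substituted for each argument of `f i`; every
integration variable is used by exactly two functions. -/
lemma lintegral_prod_comp_le (he : ∀ i, Function.Injective (e i))
    (hcard : ∀ k, Nat.card {i // k ∈ Set.range (e i)} = 2)
    (f : ∀ i, (T i → Y) → ℝ≥0∞) (hf : ∀ i, Measurable (f i)) :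
    ∫⁻ u, ∏ i, f i (u ∘ e i) ∂(Measure.pi fun _ : K => μ) ≤
      ∏ i, (∫⁻ t, f i t ^ (2 : ℝ) ∂(Measure.pi fun _ : T i => μ)) ^ (1 / 2 : ℝ) := by
  classical
  rcases isEmpty_or_nonempty (K → Y) with hemp | ⟨⟨x⟩⟩
  · simp
  rw [lintegral_eq_lmarginal_univ (μ := fun _ : K => μ) x]
  refine (lmarginal_prod_le (fun _ : K => μ) (fun i => Finset.univ.image (e i))
    (fun i u => f i (u ∘ e i)) (fun i => (hf i).comp
      (measurable_pi_lambda _ fun i => measurable_pi_apply _)) ?_ Finset.univ ?_ x).trans_eq ?_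
  · intro i x y hxy
    congr 1
    funext t
    exact hxy _ (by simp)
  · intro k _
    rw [← hcard k, Nat.card_eq_fintype_card, Fintype.card_subtype]
    congr 1
    ext i
    simp
  · refine Finset.prod_congr rfl fun i _ => ?_
    rw [Finset.univ_inter]
    have := lmarginal_image (μ := fun _ : K => μ) (he i) Finset.univ ((hf i).pow_const (2 : ℝ)) x
    congr 1
    refine this.trans ?_
    rw [lmarginal_univ]

variable {e}

lemma memLp_lintegral_prod_comp_le (he : ∀ i, Function.Injective (e i))
    (hcard : ∀ k, Nat.card {i // k ∈ Set.range (e i)} = 2)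
    {f : ∀ i, (T i → Y) → ℂ} (hf : ∀ i, MemLp (f i) 2 (Measure.pi fun _ => μ)) :
    ∫⁻ u, ‖∏ i, f i (u ∘ e i)‖ₑ ∂(Measure.pi fun _ : K => μ) ≤
      ∏ i, eLpNorm (f i) 2 (Measure.pi fun _ => μ) := by
  choose g hsm hae using fun i => (hf i).1
  have h1 : (fun u => ‖∏ i, f i (u ∘ e i)‖ₑ) =ᵐ[Measure.pi fun _ : K => μ]
      fun u => ∏ i, ‖g i (u ∘ e i)‖ₑ := by
    filter_upwards [ae_all_iff.2 fun i => ae_comp_injective (he i) (hae i)] with u hu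
    simp [enorm_eq_nnnorm, nnnorm_prod, hu]
  rw [lintegral_congr_ae h1]
  refine (lintegral_prod_comp_le e he hcard (fun i t => ‖g i t‖ₑ)
    (fun i => (hsm i).measurable.enorm)).trans_eq (Finset.prod_congr rfl fun i _ => ?_)
  refine Eq.trans ?_ (eLpNorm_congr_ae (hae i)).symm
  rw [eLpNorm_eq_lintegral_rpow_enorm_toReal (by simp) (by simp)]
  simp

lemma integrable_prod_comp (he : ∀ i, Function.Injective (e i))
    (hcard : ∀ k, Nat.card {i // k ∈ Set.range (e i)} = 2)
    {f : ∀ i, (T i → Y) → ℂ} (hf : ∀ i, MemLp (f i) 2 (Measure.pi fun _ => μ)) :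
    Integrable (fun u => ∏ i, f i (u ∘ e i)) (Measure.pi fun _ : K => μ) := by
  refine ⟨?_, ?_⟩
  · refine ⟨fun u => ∏ i, (hf i).1.mk (f i) (u ∘ e i), ?_, ?_⟩
    · exact Finset.stronglyMeasurable_fun_prod _ fun i _ =>
        (hf i).1.stronglyMeasurable_mk.comp_measurable
          (measurable_pi_lambda _ fun i => measurable_pi_apply _)
    · filter_upwards [ae_all_iff.2 fun i => ae_comp_injective (he i) (hf i).1.ae_eq_mk] with u hu
      simp [hu]
  · refine (memLp_lintegral_prod_comp_le he hcard hf).trans_lt ?_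
    exact ENNReal.prod_lt_top fun i _ => (hf i).2

lemma integral_prod_comp_congr (he : ∀ i, Function.Injective (e i))
    {f g : ∀ i, (T i → Y) → ℂ} (hfg : ∀ i, f i =ᵐ[Measure.pi fun _ => μ] g i) :
    ∫ u, ∏ i, f i (u ∘ e i) ∂(Measure.pi fun _ : K => μ) =
      ∫ u, ∏ i, g i (u ∘ e i) ∂(Measure.pi fun _ : K => μ) := by
  refine integral_congr_ae ?_
  filter_upwards [ae_all_iff.2 fun i => ae_comp_injective (he i) (hfg i)] with u hu
  simp [hu]

/-- The contraction of square integrable functions along a pairing of their variables. -/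
def contraction (μ : Measure Y) [SigmaFinite μ] (he : ∀ i, Function.Injective (e i))
    (hcard : ∀ k, Nat.card {i // k ∈ Set.range (e i)} = 2) :
    ContinuousMultilinearMap ℂ (fun i => Lp ℂ 2 (Measure.pi fun _ : T i => μ)) ℂ :=
  MultilinearMap.mkContinuous
    { toFun := fun F => ∫ u, ∏ i, F i (u ∘ e i) ∂(Measure.pi fun _ : K => μ)
      map_update_add' := by
        intro _ F i x y
        have hint := fun z => integrable_prod_comp (e := e) (μ := μ) he hcard
          (f := fun j => (Function.update F i z j : (T j → Y) → ℂ)) fun j => Lp.memLp _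
        rw [← integral_add (hint x) (hint y)]
        refine integral_congr_ae ?_
        filter_upwards [ae_comp_injective (he i) (Lp.coeFn_add x y)] with u hu
        have hprod := fun z => (Finset.mul_prod_erase Finset.univ
          (fun j => (Function.update F i z j : (T j → Y) → ℂ) (u ∘ e j)) (Finset.mem_univ i)).symm
        have herase := fun z => Finset.prod_congr (s₁ := Finset.univ.erase i) rfl
          fun j hj => congrArg (fun G : Lp ℂ 2 (Measure.pi fun _ : T j => μ) =>
            (G : (T j → Y) → ℂ) (u ∘ e j)) (Function.update_of_ne (Finset.ne_of_mem_erase hj) z F)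
        simp only [hprod, herase, Function.update_self, hu, Pi.add_apply, add_mul]
      map_update_smul' := by
        intro _ F i c x
        rw [← integral_smul]
        refine integral_congr_ae ?_
        filter_upwards [ae_comp_injective (he i) (Lp.coeFn_smul c x)] with u hu
        have hprod := fun z => (Finset.mul_prod_erase Finset.univ
          (fun j => (Function.update F i z j : (T j → Y) → ℂ) (u ∘ e j)) (Finset.mem_univ i)).symm
        have herase := fun z => Finset.prod_congr (s₁ := Finset.univ.erase i) rfl
          fun j hj => congrArg (fun G : Lp ℂ 2 (Measure.pi fun _ : T j => μ) =>
            (G : (T j → Y) → ℂ) (u ∘ e j)) (Function.update_of_ne (Finset.ne_of_mem_erase hj) z F)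
        simp only [hprod, herase, Function.update_self, hu, Pi.smul_apply, smul_mul_assoc] }
    1 fun F => by
      have h := memLp_lintegral_prod_comp_le (e := e) (μ := μ) he hcard
        (f := fun i => (F i : (T i → Y) → ℂ)) fun i => Lp.memLp _
      rw [one_mul]
      refine (norm_integral_le_lintegral_norm _).trans ?_
      simp only [Lp.norm_def, ← ENNReal.toReal_prod, ofReal_norm]
      exact ENNReal.toReal_mono (ENNReal.prod_ne_top fun i _ => (Lp.memLp (F i)).2.ne) h

lemma contraction_apply (he : ∀ i, Function.Injective (e i))
    (hcard : ∀ k, Nat.card {i // k ∈ Set.range (e i)} = 2)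
    (F : ∀ i, Lp ℂ 2 (Measure.pi fun _ : T i => μ)) :
    contraction μ he hcard F = ∫ u, ∏ i, F i (u ∘ e i) ∂(Measure.pi fun _ : K => μ) := rfl

lemma norm_contraction_le (he : ∀ i, Function.Injective (e i))
    (hcard : ∀ k, Nat.card {i // k ∈ Set.range (e i)} = 2)
    (F : ∀ i, Lp ℂ 2 (Measure.pi fun _ : T i => μ)) :
    ‖contraction μ he hcard F‖ ≤ ∏ i, ‖F i‖ := by
  refine ((contraction μ he hcard).le_of_opNorm_le
    (MultilinearMap.mkContinuous_norm_le _ zero_le_one _) F).trans_eq (one_mul _)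

end Contraction

/-! ### Operator norm bounds from the moments of a faithful state. -/

section FreeProbability

variable {H : Type*} [NormedAddCommGroup H] [InnerProductSpace ℂ H] [CompleteSpace H]

lemma VonNeumannAlgebra.isClosed_toStarSubalgebra (A : VonNeumannAlgebra H) :
    IsClosed (A.toStarSubalgebra : Set (H →L[ℂ] H)) := by
  have h : (A.toStarSubalgebra : Set (H →L[ℂ] H)) = A := rfl
  rw [h, ← A.centralizer_centralizer]
  exact Set.isClosed_centralizer _

instance WStarProbabilitySpace.cstarAlgebra (P : WStarProbabilitySpace H) :
    CStarAlgebra P.Elem :=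
  StarSubalgebra.cstarAlgebra (h_closed := P.algebra.isClosed_toStarSubalgebra) _

variable (P : WStarProbabilitySpace H)

/-- Norm convergence is eventually bounded and implies weak convergence, so normality applies. -/
lemma WStarProbabilitySpace.continuous_φ : Continuous P.φ := by
  refine continuous_iff_continuousAt.2 fun X => P.normal (‖X‖ + 1) (𝓝 X) X ?_ fun x y => ?_
  · exact (continuous_norm.tendsto X).eventually (ge_mem_nhds (lt_add_one _))
  · have h1 : Continuous fun Y : P.algebra.toStarSubalgebra => (Y : H →L[ℂ] H) y :=
      (ContinuousLinearMap.apply ℂ H y).continuous.comp continuous_subtype_val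
    exact (continuous_const.inner h1).tendsto X

lemma WStarProbabilitySpace.re_φ_star_mul_self_nonneg (X : P.Elem) :
    0 ≤ (P.φ (star X * X)).re := by
  simpa using (P.positive (star X)).1

lemma WStarProbabilitySpace.im_φ_star_mul_self (X : P.Elem) :
    (P.φ (star X * X)).im = 0 := by
  simpa using (P.positive (star X)).2

lemma WStarProbabilitySpace.re_φ_cfc_nonneg (a : P.Elem) (f : ℝ → ℝ) (hf : Continuous f)
    (h0 : ∀ x ∈ spectrum ℝ a, 0 ≤ f x) : 0 ≤ (P.φ (cfc f a)).re := by
  by_cases ha : IsSelfAdjoint a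
  · have h1 : cfc f a = star (cfc (fun x => √(f x)) a) * cfc (fun x => √(f x)) a := by
      have hsa : IsSelfAdjoint (cfc (fun x => √(f x)) a) := cfc_predicate _ _
      rw [hsa.star_eq, ← cfc_mul _ _ a (by fun_prop) (by fun_prop)]
      exact cfc_congr fun x hx => (Real.mul_self_sqrt (h0 x hx)).symm
    rw [h1]
    exact P.re_φ_star_mul_self_nonneg _
  · rw [cfc_apply_of_not_predicate a ha]; simp

/-- If the top `‖Z‖ ^ 2` of the spectrum of `Z* Z` exceeded `K`, faithfulness would give positive
mass to the part of the spectrum above some `c > K`, and the moments would grow at least like `c ^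
m`. -/
lemma WStarProbabilitySpace.norm_sq_le_of_moments (Z : P.Elem) (C K : ℝ)
    (h : ∀ m : ℕ, (P.φ ((star Z * Z) ^ m)).re ≤ C * K ^ m) (hK : 0 ≤ K) : ‖Z‖ ^ 2 ≤ K := by
  by_contra! hlt
  have hZ0 : Z ≠ 0 := by rintro rfl; simp at hlt; linarith
  have : Nontrivial P.Elem := ⟨⟨Z, 0, hZ0⟩⟩
  set a : P.Elem := star Z * Z with ha
  have hsa : IsSelfAdjoint a := IsSelfAdjoint.star_mul_self Z
  have hnorm : ‖a‖ = ‖Z‖ ^ 2 := by rw [ha, CStarRing.norm_star_mul_self, sq]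
  obtain ⟨c, hKc, hcM⟩ := exists_between hlt
  have hc : 0 < c := hK.trans_lt hKc
  set M := ‖Z‖ ^ 2 with hM
  have hM0 : 0 < M := hc.trans hcM
  have hspec_le : ∀ x ∈ spectrum ℝ a, |x| ≤ M := fun x hx => by
    rw [← hnorm]; exact spectrum.norm_le_norm_of_mem hx
  have hspec_nonneg : ∀ x ∈ spectrum ℝ a, 0 ≤ x := spectrum_star_mul_self_nonneg (b := Z)
  have hMmem : M ∈ spectrum ℝ a := by
    let := CStarAlgebra.spectralOrder P.Elem
    have := CStarAlgebra.spectralOrderedRing P.Elem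
    rw [← hnorm]
    exact CStarAlgebra.norm_mem_spectrum_of_nonneg (star_mul_self_nonneg Z)
  -- A continuous function supported above `c` replaces the spectral projection. On the spectrum `c
  -- ^ m * g x ^ 2 ≤ M ^ 2 * x ^ m`.
  set g : ℝ → ℝ := fun x => max (x - c) 0 with hg
  have hgc : Continuous g := by fun_prop
  set b := cfc g a with hb
  have hbsa : IsSelfAdjoint b := cfc_predicate _ _
  have hb0 : b ≠ 0 := by
    intro h0
    have h1 : g M ∈ spectrum ℝ b := by
      rw [hb, cfc_map_spectrum g a]
      exact ⟨M, hMmem, rfl⟩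
    rw [h0, spectrum.zero_eq, Set.mem_singleton_iff] at h1
    have : 0 < g M := lt_max_of_lt_left (sub_pos.2 hcM)
    linarith
  have hbpos : 0 < (P.φ (b * b)).re := by
    have h1 := P.re_φ_star_mul_self_nonneg b
    have h2 := P.im_φ_star_mul_self b
    rw [hbsa.star_eq] at h1 h2
    refine h1.lt_of_ne fun h3 => hb0 (P.faithful b ?_)
    rw [hbsa.star_eq]
    exact Complex.ext h3.symm h2
  have hkey : ∀ m : ℕ, c ^ m * (P.φ (b * b)).re ≤ M ^ 2 * (C * K ^ m) := by
    intro m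
    have h1 : cfc (fun x => M ^ 2 * x ^ m - c ^ m * (g x * g x)) a =
        ((M ^ 2 : ℝ) : ℂ) • a ^ m - ((c ^ m : ℝ) : ℂ) • (b * b) := by
      rw [cfc_sub _ _ a (by fun_prop) (by fun_prop), cfc_const_mul _ _ a (by fun_prop),
        cfc_const_mul _ _ a (by fun_prop), cfc_mul _ _ a (by fun_prop) (by fun_prop),
        cfc_pow_id a m, Complex.coe_smul, Complex.coe_smul]
    have h2 := P.re_φ_cfc_nonneg a (fun x => M ^ 2 * x ^ m - c ^ m * (g x * g x)) (by fun_prop)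
      (fun x hx => by
        have hx0 := hspec_nonneg x hx
        have hxM := (le_abs_self x).trans (hspec_le x hx)
        rw [sub_nonneg]
        rcases le_total x c with hxc | hxc
        · have : g x = 0 := max_eq_right (by linarith)
          rw [this, mul_zero, mul_zero]
          positivity
        · have h3 : g x = x - c := max_eq_left (by linarith)
          have h4 : c ^ m ≤ x ^ m := by gcongr
          have h5 : g x * g x ≤ M ^ 2 := by rw [h3]; nlinarith
          rw [mul_comm (M ^ 2)]
          have h6 : 0 ≤ g x * g x := mul_self_nonneg _
          gcongr)
    rw [h1, map_sub, map_smul, map_smul, smul_eq_mul, smul_eq_mul, Complex.sub_re,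
      Complex.re_ofReal_mul, Complex.re_ofReal_mul, sub_nonneg] at h2
    refine h2.trans ?_
    gcongr
    exact h m
  have hlim : Tendsto (fun m : ℕ => M ^ 2 * C * (K / c) ^ m) atTop (𝓝 (M ^ 2 * C * 0)) :=
    (tendsto_pow_atTop_nhds_zero_of_lt_one (by positivity) ((div_lt_one hc).2 hKc)).const_mul _
  have hle : (P.φ (b * b)).re ≤ M ^ 2 * C * 0 := by
    refine ge_of_tendsto' hlim fun m => ?_
    rw [div_pow, ← mul_div_assoc, le_div_iff₀ (by positivity), mul_comm]
    linarith [hkey m]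
  linarith

/-- Parallelogram estimate for the seminorm of `φ`. -/
lemma WStarProbabilitySpace.re_φ_star_mul_self_sub_le (X Y Z : P.Elem) :
    (P.φ (star (X - Z) * (X - Z))).re ≤
      2 * (P.φ (star (Y - X) * (Y - X))).re + 2 * (P.φ (star (Y - Z) * (Y - Z))).re := by
  have h := P.re_φ_star_mul_self_nonneg ((Y - X) + (Y - Z))
  have h2 : star (X - Z) * (X - Z) + star ((Y - X) + (Y - Z)) * ((Y - X) + (Y - Z)) =
      (2 : ℂ) • (star (Y - X) * (Y - X)) + (2 : ℂ) • (star (Y - Z) * (Y - Z)) := by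
    simp only [two_smul, star_sub, star_add]
    noncomm_ring
  have h3 := congrArg (fun x => (P.φ x).re) h2
  simp only [map_add, map_smul, smul_eq_mul, Complex.add_re, Complex.mul_re, Complex.re_ofNat,
    Complex.im_ofNat, zero_mul, sub_zero] at h3
  linarith

end FreeProbability

/-! ### Off-diagonal boxes determine square integrable functions. -/

section Density

lemma ae_injective_lebesguePosPi (ι : Type*) [Fintype ι] :
    ∀ᵐ t ∂(lebesguePosPi ι), Function.Injective t := by
  classical
  have h : ∀ j k : ι, j ≠ k → ∀ᵐ t ∂(lebesguePosPi ι), t j ≠ t k := by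
    intro j k hjk
    have hms : MeasurableSet {t : ι → ℝ≥0 | t j = t k} :=
      measurableSet_eq_fun (measurable_pi_apply j) (measurable_pi_apply k)
    have h0 : ∫⁻ t, {t : ι → ℝ≥0 | t j = t k}.indicator (1 : (ι → ℝ≥0) → ℝ≥0∞) t
        ∂(lebesguePosPi ι) = ∫⁻ t : ι → ℝ≥0, 0 ∂(lebesguePosPi ι) := by
      refine lintegral_eq_of_lmarginal_eq {k} (measurable_one.indicator hms) measurable_zero ?_
      funext x
      rw [lmarginal_singleton, lmarginal_singleton]
      have : ∀ y, {t : ι → ℝ≥0 | t j = t k}.indicator (1 : (ι → ℝ≥0) → ℝ≥0∞)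
          (Function.update x k y) = ({x j} : Set ℝ≥0).indicator 1 y := fun y => by
        simp [Set.indicator_apply, Function.update_of_ne hjk, eq_comm]
      simp only [this]
      rw [lintegral_indicator_one (measurableSet_singleton _), lebesguePos_singleton]
      simp
    rw [lintegral_indicator_one hms, lintegral_zero] at h0
    simpa [ae_iff] using h0
  filter_upwards [ae_all_iff.2 fun j => ae_all_iff.2 fun k => ae_all_iff.2 fun hjk => h j k hjk]
    with t ht j k hjk
  by_contra hne
  exact ht j k hne hjk

lemma lebesguePosPi_box_lt_top {ι : Type*} [Fintype ι] (a b : ι → ℝ≥0) :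
    lebesguePosPi ι (Set.univ.pi fun j => Set.Icc (a j) (b j)) < ∞ := by
  rw [Measure.pi_pi]
  exact ENNReal.prod_lt_top fun j _ => by rw [lebesguePos_Icc]; exact ENNReal.ofReal_lt_top

lemma measurableSet_box {ι : Type*} [Fintype ι] (a b : ι → ℝ≥0) :
    MeasurableSet (Set.univ.pi fun j => Set.Icc (a j) (b j)) :=
  MeasurableSet.univ_pi fun _ => measurableSet_Icc

/-- A function that integrates to zero over all subboxes of a box vanishes on this box. -/
lemma ae_eq_zero_of_integral_subbox {ι : Type*} [Fintype ι] {F : (ι → ℝ≥0) → ℂ}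
    (a b : ι → ℝ≥0)
    (hF : IntegrableOn F (Set.univ.pi fun j => Set.Icc (a j) (b j)) (lebesguePosPi ι))
    (h : ∀ d : ι → ℝ≥0, (∀ j, a j ≤ d j) → (∀ j, d j ≤ b j) →
      ∫ t in Set.univ.pi fun j => Set.Icc (a j) (d j), F t ∂(lebesguePosPi ι) = 0)
    (hab : ∀ j, a j ≤ b j) :
    ∀ᵐ t ∂(lebesguePosPi ι), t ∈ (Set.univ.pi fun j => Set.Icc (a j) (b j)) → F t = 0 := by
  set Q := Set.univ.pi fun j => Set.Icc (a j) (b j) with hQ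
  have hQm : MeasurableSet Q := measurableSet_box a b
  rw [← ae_restrict_iff' hQm]
  refine Integrable.ae_eq_zero_of_forall_setIntegral_eq_zero hF fun E hE _ => ?_
  -- Products of lower half-lines form a generating π-system, and they cut the box in subboxes with
  -- the same lower corner `a`.
  have hgen : (MeasurableSpace.pi : MeasurableSpace (ι → ℝ≥0)) =
      MeasurableSpace.generateFrom
        (Set.univ.pi '' Set.univ.pi fun _ : ι => Set.range (Set.Iic : ℝ≥0 → Set ℝ≥0)) := by
    rw [← generateFrom_pi_eq]
    · congr 1
      funext _
      rw [← borel_eq_generateFrom_Iic]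
      exact BorelSpace.measurable_eq
    · exact fun _ => ⟨fun n => Set.Iic n, fun n => ⟨n, rfl⟩, Set.eq_univ_of_forall fun x =>
        Set.mem_iUnion.2 (exists_nat_ge x)⟩
  induction E, hE using MeasurableSpace.induction_on_inter hgen with
  | h_inter =>
    refine IsPiSystem.pi fun _ => ?_
    simpa using isPiSystem_image_Iic (Set.univ : Set ℝ≥0)
  | empty => simp
  | basic E hE =>
    obtain ⟨s, hs, rfl⟩ := hE
    choose d hd using fun j => hs j trivial
    have hE : MeasurableSet (Set.univ.pi s) :=
      MeasurableSet.univ_pi fun j => by rw [← hd j]; exact measurableSet_Iic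
    rw [Measure.restrict_restrict hE]
    have hset : Set.univ.pi s ∩ Q = Set.univ.pi fun j => Set.Icc (a j) (min (b j) (d j)) := by
      rw [hQ, ← Set.pi_inter_distrib]
      refine congrArg _ (funext fun j => ?_)
      rw [← hd j]
      ext x
      simp only [Set.mem_inter_iff, Set.mem_Iic, Set.mem_Icc, le_min_iff]
      tauto
    rw [hset]
    by_cases hle : ∀ j, a j ≤ min (b j) (d j)
    · exact h _ hle fun j => min_le_left _ _
    · push Not at hle
      obtain ⟨j, hj⟩ := hle
      have hempty : Set.Icc (a j) (min (b j) (d j)) = ∅ := Set.Icc_eq_empty (not_le.2 hj)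
      rw [Set.univ_pi_eq_empty (i := j) hempty]
      simp
  | compl E hE ih =>
    have h1 := integral_add_compl hE hF
    rw [ih (measure_lt_top_of_subset (Set.subset_univ _) (by
      rw [Measure.restrict_apply_univ]; exact (lebesguePosPi_box_lt_top a b).ne)), zero_add] at h1
    rw [h1]
    exact h b hab fun _ => le_rfl
  | iUnion E hd hE ih =>
    have h1 := hasSum_integral_iUnion hE hd (μ := (lebesguePosPi ι).restrict Q) (f := F)
      hF.integrableOn
    have h2 : ∀ i, ∫ x in E i, F x ∂((lebesguePosPi ι).restrict Q) = 0 := fun i =>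
      ih i (measure_lt_top_of_subset (Set.subset_univ _) (by
        rw [Measure.restrict_apply_univ]; exact (lebesguePosPi_box_lt_top a b).ne))
    simp only [h2] at h1
    exact h1.unique hasSum_zero

lemma exists_separating_box {ι : Type*} [Fintype ι] (t : ι → ℝ≥0) (ht : Function.Injective t) :
    ∃ (m : ℕ) (p : ι → ℕ), (∀ j k, j ≠ k →
      Disjoint (Set.Icc ((p j : ℝ≥0) / (m + 1)) ((p j + 1 : ℝ≥0) / (m + 1)))
        (Set.Icc ((p k : ℝ≥0) / (m + 1)) ((p k + 1 : ℝ≥0) / (m + 1)))) ∧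
      t ∈ Set.univ.pi fun j => Set.Icc ((p j : ℝ≥0) / (m + 1)) ((p j + 1 : ℝ≥0) / (m + 1)) := by
  -- With mesh `1 / (m + 1)`, a point common to two cells would be within one mesh of both
  -- coordinates, which are more than two meshes apart.
  have hev : ∀ᶠ m : ℕ in atTop, ∀ j k, j ≠ k → 2 * (1 / ((m : ℝ) + 1)) < dist (t j) (t k) := by
    rw [eventually_all]; intro j
    rw [eventually_all]; intro k
    rw [eventually_all]; intro hjk
    have h1 : Tendsto (fun m : ℕ => 2 * (1 / ((m : ℝ) + 1))) atTop (𝓝 (2 * 0)) :=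
      tendsto_one_div_add_atTop_nhds_zero_nat.const_mul 2
    rw [mul_zero] at h1
    exact h1.eventually_lt_const (dist_pos.2 (ht.ne hjk))
  obtain ⟨m, hm⟩ := hev.exists
  have hmem : ∀ j, t j ∈ Set.Icc ((⌊t j * (m + 1)⌋₊ : ℝ≥0) / (m + 1))
      ((⌊t j * (m + 1)⌋₊ + 1 : ℝ≥0) / (m + 1)) := fun j => by
    have hpos : (0 : ℝ≥0) < m + 1 := by positivity
    exact ⟨(div_le_iff₀ hpos).2 (Nat.floor_le zero_le),
      (le_div_iff₀ hpos).2 (Nat.lt_floor_add_one _).le⟩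
  refine ⟨m, fun j => ⌊t j * (m + 1)⌋₊, fun j k hjk => ?_, fun j _ => hmem j⟩
  rw [Set.disjoint_left]
  intro x hxj hxk
  have key : ∀ l, x ∈ Set.Icc ((⌊t l * (m + 1)⌋₊ : ℝ≥0) / (m + 1))
      ((⌊t l * (m + 1)⌋₊ + 1 : ℝ≥0) / (m + 1)) → dist (t l) x ≤ 1 / ((m : ℝ) + 1) := by
    intro l hx
    have hl := hmem l
    rw [NNReal.dist_eq, abs_le]
    simp only [Set.mem_Icc, ← NNReal.coe_le_coe, NNReal.coe_div, NNReal.coe_add, NNReal.coe_natCast,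
      NNReal.coe_one, add_div] at hx hl
    constructor <;> linarith [hx.1, hx.2, hl.1, hl.2]
  have h1 := dist_triangle_right (t j) (t k) x
  linarith [hm j k hjk, key j hxj, key k hxk]

/-- A square integrable function that integrates to zero over all off-diagonal boxes vanishes. -/
lemma ae_eq_zero_of_integral_offDiagonal_box {ι : Type*} [Fintype ι] {F : (ι → ℝ≥0) → ℂ}
    (hF : MemLp F 2 (lebesguePosPi ι))
    (h : ∀ a b : ι → ℝ≥0, (∀ j, a j ≤ b j) →
      (∀ j k, j ≠ k → Disjoint (Set.Icc (a j) (b j)) (Set.Icc (a k) (b k))) →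
      ∫ t in Set.univ.pi fun j => Set.Icc (a j) (b j), F t ∂(lebesguePosPi ι) = 0) :
    F =ᵐ[lebesguePosPi ι] 0 := by
  have h1 : ∀ q : ℕ × (ι → ℕ), (∀ j k, j ≠ k →
      Disjoint (Set.Icc ((q.2 j : ℝ≥0) / (q.1 + 1)) ((q.2 j + 1 : ℝ≥0) / (q.1 + 1)))
        (Set.Icc ((q.2 k : ℝ≥0) / (q.1 + 1)) ((q.2 k + 1 : ℝ≥0) / (q.1 + 1)))) →
      ∀ᵐ t ∂(lebesguePosPi ι), t ∈ (Set.univ.pi fun j =>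
        Set.Icc ((q.2 j : ℝ≥0) / (q.1 + 1)) ((q.2 j + 1 : ℝ≥0) / (q.1 + 1))) → F t = 0 := by
    intro q hq
    have hle : ∀ j, (q.2 j : ℝ≥0) / (q.1 + 1) ≤ (q.2 j + 1 : ℝ≥0) / (q.1 + 1) := fun j => by
      gcongr; exact le_self_add
    refine ae_eq_zero_of_integral_subbox _ _ ?_ (fun d hd hd' => h _ _ hd fun j k hjk => ?_) hle
    · have : IsFiniteMeasure ((lebesguePosPi ι).restrict (Set.univ.pi fun j =>
          Set.Icc ((q.2 j : ℝ≥0) / (q.1 + 1)) ((q.2 j + 1 : ℝ≥0) / (q.1 + 1)))) :=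
        ⟨by rw [Measure.restrict_apply_univ]; exact lebesguePosPi_box_lt_top _ _⟩
      exact (hF.restrict _).integrable one_le_two
    · exact (hq j k hjk).mono (Set.Icc_subset_Icc_right (hd' j)) (Set.Icc_subset_Icc_right (hd' k))
  -- The grid boxes form a countable family, so their exceptional null sets can be discarded
  -- together.
  filter_upwards [ae_injective_lebesguePosPi ι, ae_all_iff.2 fun q => ae_all_iff.2 (h1 q)]
    with t ht htq
  obtain ⟨m, p, hp, htp⟩ := exists_separating_box t ht
  exact htq (m, p) hp htp

end Density

/-! ### The step integral as a graph over `L²`. -/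

section FreeProbability

variable {H : Type*} [NormedAddCommGroup H] [InnerProductSpace ℂ H] [CompleteSpace H]

/-- The graph of the Wigner integral on off-diagonal step functions as a subspace of
`L²(ℝ₊ⁿ) × 𝒜`. -/
def wignerStepLp (P : WStarProbabilitySpace H) (S : ℝ≥0 → P.Elem) (n : ℕ) :
    Submodule ℂ (Lp ℂ 2 (lebesguePosPi (Fin n)) × P.Elem) :=
  Submodule.span ℂ {p | ∃ a b : Fin n → ℝ≥0, (∀ j, a j ≤ b j) ∧
    (∀ j k, j ≠ k → Disjoint (Set.Icc (a j) (b j)) (Set.Icc (a k) (b k))) ∧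
    (p.1 : (Fin n → ℝ≥0) → ℂ) =ᵐ[lebesguePosPi (Fin n)]
      Set.indicator (Set.univ.pi fun j => Set.Icc (a j) (b j)) (fun _ => (1 : ℂ)) ∧
    p.2 = (List.ofFn fun j => S (b j) - S (a j)).prod}

variable {P : WStarProbabilitySpace H} {S : ℝ≥0 → P.Elem} {n : ℕ}

lemma exists_mem_wignerStepLp {q : ((Fin n → ℝ≥0) → ℂ) × P.Elem}
    (hq : q ∈ wignerStepGraph P S n) : ∃ F : Lp ℂ 2 (lebesguePosPi (Fin n)),
      (F, q.2) ∈ wignerStepLp P S n ∧ F =ᵐ[lebesguePosPi (Fin n)] q.1 := by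
  induction hq using Submodule.span_induction with
  | mem q hq =>
    obtain ⟨a, b, hab, hd, h1, h2⟩ := hq
    have hae := indicatorConstLp_coeFn (p := 2) (hs := measurableSet_box a b)
      (hμs := (lebesguePosPi_box_lt_top a b).ne) (c := (1 : ℂ))
    exact ⟨_, Submodule.subset_span ⟨a, b, hab, hd, hae, h2⟩, by rw [h1]; exact hae⟩
  | zero => exact ⟨0, Submodule.zero_mem _, Lp.coeFn_zero _ _ _⟩
  | add p q _ _ hp hq =>
    obtain ⟨F, hF, hF'⟩ := hp
    obtain ⟨G, hG, hG'⟩ := hq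
    exact ⟨F + G, Submodule.add_mem _ hF hG, (Lp.coeFn_add F G).trans (hF'.add hG')⟩
  | smul c p _ hp =>
    obtain ⟨F, hF, hF'⟩ := hp
    exact ⟨c • F, Submodule.smul_mem _ c hF, (Lp.coeFn_smul c F).trans (hF'.const_smul c)⟩

lemma exists_mem_wignerStepGraph {p : Lp ℂ 2 (lebesguePosPi (Fin n)) × P.Elem}
    (hp : p ∈ wignerStepLp P S n) : ∃ g : (Fin n → ℝ≥0) → ℂ,
      (g, p.2) ∈ wignerStepGraph P S n ∧ p.1 =ᵐ[lebesguePosPi (Fin n)] g := by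
  induction hp using Submodule.span_induction with
  | mem p hp =>
    obtain ⟨a, b, hab, hd, h1, h2⟩ := hp
    exact ⟨_, Submodule.subset_span ⟨a, b, hab, hd, rfl, h2⟩, h1⟩
  | zero => exact ⟨0, Submodule.zero_mem _, Lp.coeFn_zero _ _ _⟩
  | add p q _ _ hp hq =>
    obtain ⟨F, hF, hF'⟩ := hp
    obtain ⟨G, hG, hG'⟩ := hq
    exact ⟨F + G, Submodule.add_mem _ hF hG, (Lp.coeFn_add _ _).trans (hF'.add hG')⟩
  | smul c p _ hp =>
    obtain ⟨F, hF, hF'⟩ := hp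
    exact ⟨c • F, Submodule.smul_mem _ c hF, (Lp.coeFn_smul c _).trans (hF'.const_smul c)⟩

lemma topologicalClosure_map_fst_wignerStepLp (P : WStarProbabilitySpace H) (S : ℝ≥0 → P.Elem)
    (n : ℕ) : ((wignerStepLp P S n).map (LinearMap.fst ℂ _ _)).topologicalClosure = ⊤ := by
  rw [Submodule.topologicalClosure_eq_top_iff, Submodule.eq_bot_iff]
  intro F hF
  rw [Submodule.mem_orthogonal] at hF
  refine Lp.ext ((ae_eq_zero_of_integral_offDiagonal_box (Lp.memLp F) fun a b hab hd => ?_).trans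
    (Lp.coeFn_zero _ _ _).symm)
  rw [← L2.inner_indicatorConstLp_one (measurableSet_box a b) (lebesguePosPi_box_lt_top a b).ne]
  exact hF _ (Submodule.mem_map.2 ⟨(indicatorConstLp 2 (measurableSet_box a b)
    (lebesguePosPi_box_lt_top a b).ne 1, _), Submodule.subset_span
      ⟨a, b, hab, hd, indicatorConstLp_coeFn (hs := measurableSet_box a b)
        (hμs := (lebesguePosPi_box_lt_top a b).ne), rfl⟩, rfl⟩)

end FreeProbability

/-! ### Multilinear extension and products of lists. -/

section Generalities

lemma MultilinearMap.eq_of_forall_mem_span {R ι N : Type*} {M : ι → Type*} [Finite ι] [Semiring R]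
    [∀ i, AddCommMonoid (M i)] [∀ i, Module R (M i)] [AddCommMonoid N] [Module R N]
    {f g : MultilinearMap R M N} {s : ∀ i, Set (M i)}
    (h : ∀ m, (∀ i, m i ∈ s i) → f m = g m) (m : ∀ i, M i)
    (hm : ∀ i, m i ∈ Submodule.span R (s i)) : f m = g m := by
  classical
  cases nonempty_fintype ι
  suffices ∀ (t : Finset ι) (m : ∀ i, M i), (∀ i ∈ t, m i ∈ Submodule.span R (s i)) →
      (∀ i ∉ t, m i ∈ s i) → f m = g m from
    this Finset.univ m (fun i _ => hm i) (by simp)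
  intro t
  induction t using Finset.induction_on with
  | empty => exact fun m _ hm => h m fun i => hm i (by simp)
  | insert a t ha ih =>
    intro m hm hm'
    have h1 : Set.EqOn (f.toLinearMap m a) (g.toLinearMap m a) (s a) := fun x hx => by
      refine ih _ (fun i hi => ?_) fun i hi => ?_
      · have hia : i ≠ a := by rintro rfl; exact ha hi
        rw [Function.update_of_ne hia]
        exact hm i (Finset.mem_insert_of_mem hi)
      · by_cases hia : i = a
        · subst hia; rwa [Function.update_self]
        · rw [Function.update_of_ne hia]
          exact hm' i (by simp [hia, hi])
    simpa using LinearMap.eqOn_span h1 (hm a (Finset.mem_insert_self a t))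

lemma List.prod_ofFn_finSigmaFinEquiv {M : Type*} [Monoid M] {r : ℕ} (n : Fin r → ℕ)
    (h : Fin (∑ i, n i) → M) :
    (List.ofFn fun i => (List.ofFn fun j : Fin (n i) => h (finSigmaFinEquiv ⟨i, j⟩)).prod).prod =
      (List.ofFn h).prod := by
  induction r with
  | zero => rw [List.ofFn_congr (Fin.sum_univ_zero n) h]; simp
  | succ r ih =>
    have hsum := Fin.sum_univ_castSucc n
    rw [List.ofFn_succ', List.concat_eq_append, List.prod_append, List.prod_singleton,
      List.ofFn_congr hsum h, List.ofFn_add, List.prod_append, ← ih]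
    congr 1
    · refine congrArg _ (congrArg _ (funext fun i => ?_))
      refine congrArg _ (congrArg _ (funext fun j => congrArg h (Fin.ext ?_)))
      simp [finSigmaFinEquiv_apply]
    · refine congrArg _ (congrArg _ (funext fun j => congrArg h (Fin.ext ?_)))
      simp [finSigmaFinEquiv_apply]
      rfl

lemma List.star_prod_ofFn {M : Type*} [Monoid M] [StarMul M] {n : ℕ} (h : Fin n → M) :
    star (List.ofFn h).prod = (List.ofFn fun j => star (h j.rev)).prod := by
  induction n with
  | zero => simp
  | succ n ih =>
    rw [List.ofFn_succ, List.prod_cons, star_mul, ih, List.ofFn_succ', List.concat_eq_append,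
      List.prod_append, List.prod_singleton]
    simp [Fin.rev_castSucc]

lemma List.prod_ofFn_alternating {M : Type*} [Monoid M] (x y : M) (m : ℕ) :
    (List.ofFn fun i : Fin (m * 2) => if (i : ℕ) % 2 = 0 then x else y).prod = (x * y) ^ m := by
  rw [List.ofFn_mul]
  simp [List.prod_flatten, Nat.add_mod]

end Generalities

/-! ### Respectful pairings and their contractions. -/

section Pairings

variable {r : ℕ} {n : Fin r → ℕ}

/-- The block of `π` that contains the `j`-th element of the `i`-th interval. -/
def blockOf (π : Finpartition (Finset.univ : Finset (Fin (∑ i, n i)))) (i : Fin r)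
    (j : Fin (n i)) : π.parts :=
  ⟨π.part (finSigmaFinEquiv ⟨i, j⟩), π.part_mem.2 (Finset.mem_univ _)⟩

lemma mem_respectfulNCPairings {π : Finpartition (Finset.univ : Finset (Fin (∑ i, n i)))} :
    π ∈ respectfulNCPairings n ↔ IsPairing π ∧ ¬ HasCrossing π ∧ Respects n π := by
  simp [respectfulNCPairings]

lemma mem_intervalBlock (i : Fin r) (x : Fin (∑ i, n i)) :
    x ∈ intervalBlock n i ↔ (finSigmaFinEquiv.symm x).1 = i := by
  simp only [intervalBlock, Finset.mem_image, Finset.mem_univ, true_and]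
  constructor
  · rintro ⟨j, rfl⟩
    simp
  · rintro rfl
    exact ⟨(finSigmaFinEquiv.symm x).2, by simp⟩

lemma Respects.eq_of_mem {π : Finpartition (Finset.univ : Finset (Fin (∑ i, n i)))}
    (hπ : Respects n π) {B : Finset (Fin (∑ i, n i))} (hB : B ∈ π.parts) {x y : Fin (∑ i, n i)}
    (hx : x ∈ B) (hy : y ∈ B)
    (hxy : (finSigmaFinEquiv.symm x).1 = (finSigmaFinEquiv.symm y).1) : x = y :=
  Finset.card_le_one.1 (hπ B hB _) x
    (Finset.mem_inter.2 ⟨hx, (mem_intervalBlock _ x).2 rfl⟩) y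
    (Finset.mem_inter.2 ⟨hy, (mem_intervalBlock _ y).2 hxy.symm⟩)

lemma blockOf_injective {π : Finpartition (Finset.univ : Finset (Fin (∑ i, n i)))}
    (hπ : Respects n π) (i : Fin r) : Function.Injective (blockOf π i) := by
  intro j k hjk
  have h1 : π.part (finSigmaFinEquiv ⟨i, j⟩) = π.part (finSigmaFinEquiv ⟨i, k⟩) :=
    congrArg Subtype.val hjk
  have hmem := π.part_mem.2 (Finset.mem_univ (finSigmaFinEquiv ⟨i, j⟩))
  have := hπ.eq_of_mem hmem (π.mem_part (Finset.mem_univ _))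
    (h1 ▸ π.mem_part (Finset.mem_univ (finSigmaFinEquiv ⟨i, k⟩))) (by simp)
  simpa using this

/-- The two points of a block lie in different intervals, so the block variable enters exactly two
of the functions. This is the hypothesis of the Cauchy-Schwarz bound. -/
lemma card_mem_range_blockOf {π : Finpartition (Finset.univ : Finset (Fin (∑ i, n i)))}
    (hp : IsPairing π) (hπ : Respects n π) (B : π.parts) :
    Nat.card {i // B ∈ Set.range (blockOf π i)} = 2 := by
  rw [← hp B.1 B.2, ← Fintype.card_coe, ← Nat.card_eq_fintype_card]
  have hblock (x : B.1) : blockOf π (finSigmaFinEquiv.symm x.1).1 (finSigmaFinEquiv.symm x.1).2 =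
      B := by
    refine Subtype.ext ?_
    simp only [blockOf, Sigma.eta, Equiv.apply_symm_apply]
    exact π.part_eq_of_mem B.2 x.2
  refine (Nat.card_eq_of_bijective (fun x : B.1 => (⟨(finSigmaFinEquiv.symm x.1).1,
    (finSigmaFinEquiv.symm x.1).2, hblock x⟩ : {i // B ∈ Set.range (blockOf π i)})) ⟨?_, ?_⟩).symm
  · intro x y hxy
    exact Subtype.ext (hπ.eq_of_mem B.2 x.2 y.2 (congrArg Subtype.val hxy))
  · rintro ⟨i, j, rfl⟩
    exact ⟨⟨finSigmaFinEquiv ⟨i, j⟩, π.mem_part (Finset.mem_univ _)⟩, Subtype.ext (by simp)⟩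

lemma isNCPairing_parts {N : ℕ} {π : Finpartition (Finset.univ : Finset (Fin N))}
    (hp : IsPairing π) (hc : ¬ HasCrossing π) : IsNCPairing Finset.univ π.parts where
  card := hp
  subset _ _ := Finset.subset_univ _
  disjoint _ hB _ hB' hne := π.disjoint hB hB' hne
  cover x _ := π.exists_mem (Finset.mem_univ x)
  noncrossing B hB B' hB' hne x hx y hy x' hx' y' hy' h1 h2 h3 :=
    hc ⟨B, hB, B', hB', hne, x, hx, y, hy, x', hx', y', hy', h1, h2, h3⟩

lemma mem_ncPairings_finRange {N : ℕ} {p : Finset (Finset (Fin N))} :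
    p ∈ ncPairings [] (List.finRange N) ↔ IsNCPairing Finset.univ p := by
  have h : (List.finRange N).toFinset = Finset.univ := by ext; simp
  rw [mem_ncPairings, List.toFinset_nil, Finset.empty_union, h, and_iff_left_iff_imp]
  intro hp B hB hsub
  have := hp.card B hB
  rw [Finset.subset_empty.1 hsub] at this
  simp at this

lemma IsNCPairing.exists_finpartition {N : ℕ} {p : Finset (Finset (Fin N))}
    (hp : IsNCPairing Finset.univ p) :
    ∃ π : Finpartition (Finset.univ : Finset (Fin N)),
      π.parts = p ∧ IsPairing π ∧ ¬ HasCrossing π := by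
  refine ⟨⟨p, ?_, ?_, ?_⟩, rfl, hp.card, ?_⟩
  · rw [Finset.supIndep_iff_pairwiseDisjoint]
    exact fun B hB B' hB' hne => hp.disjoint B hB B' hB' hne
  · refine Finset.eq_univ_of_forall fun x => ?_
    obtain ⟨B, hB, hx⟩ := hp.cover x (Finset.mem_univ x)
    exact Finset.mem_sup.2 ⟨B, hB, hx⟩
  · intro h
    simpa using hp.card _ h
  · rintro ⟨B, hB, B', hB', hne, x, hx, y, hy, x', hx', y', hy', h1, h2, h3⟩
    exact hp.noncrossing B hB B' hB' hne x hx y hy x' hx' y' hy' h1 h2 h3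

lemma card_respectfulNCPairings_le (n : Fin r → ℕ) :
    (respectfulNCPairings n).card ≤ 2 ^ ∑ i, n i := by
  refine (Finset.card_le_card_of_injOn (t := ncPairings [] (List.finRange (∑ i, n i)))
    Finpartition.parts (fun π hπ => ?_) fun π _ π' _ h => Finpartition.ext h).trans ?_
  · obtain ⟨h1, h2, -⟩ := mem_respectfulNCPairings.1 hπ
    exact mem_ncPairings_finRange.2 (isNCPairing_parts h1 h2)
  · simpa using card_ncPairings_le [] (List.finRange (∑ i, n i))
      (by simpa using List.pairwise_lt_finRange _)

/-- Pairings that are not respectful have a block of weight zero; for off-diagonal boxes this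
happens because two sides of one box are disjoint. -/
lemma sum_respectfulNCPairings (n : Fin r → ℕ) (w : Finset (Fin (∑ i, n i)) → ℂ)
    (hw : ∀ B, (∃ x ∈ B, ∃ y ∈ B, x ≠ y ∧
      (finSigmaFinEquiv.symm x).1 = (finSigmaFinEquiv.symm y).1) → w B = 0) :
    ∑ π ∈ respectfulNCPairings n, ∏ B ∈ π.parts, w B =
      ∑ p ∈ ncPairings [] (List.finRange (∑ i, n i)), ∏ B ∈ p, w B := by
  refine Finset.sum_bij_ne_zero (fun π _ _ => π.parts) ?_ ?_ ?_ ?_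
  · intro π hπ _
    obtain ⟨h1, h2, -⟩ := mem_respectfulNCPairings.1 hπ
    exact mem_ncPairings_finRange.2 (isNCPairing_parts h1 h2)
  · exact fun π _ _ π' _ _ h => Finpartition.ext h
  · intro p hp hne
    obtain ⟨π, rfl, h1, h2⟩ := (mem_ncPairings_finRange.1 hp).exists_finpartition
    refine ⟨π, mem_respectfulNCPairings.2 ⟨h1, h2, fun B hB i => ?_⟩, hne, rfl⟩
    refine Finset.card_le_one.2 fun x hx y hy => ?_
    by_contra hxy
    refine hne (Finset.prod_eq_zero hB (hw B ⟨x, (Finset.mem_inter.1 hx).1, y,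
      (Finset.mem_inter.1 hy).1, hxy, ?_⟩))
    rw [(mem_intervalBlock i x).1 (Finset.mem_inter.1 hx).2,
      (mem_intervalBlock i y).1 (Finset.mem_inter.1 hy).2]
  · exact fun _ _ _ => rfl

lemma onBlocks_tensorFun (π : Finpartition (Finset.univ : Finset (Fin (∑ i, n i))))
    (f : ∀ i, (Fin (n i) → ℝ≥0) → ℂ) :
    onBlocks π (tensorFun f) = fun u => ∏ i, f i (u ∘ blockOf π i) := rfl

lemma indicator_univ_pi_one {ι Y : Type*} [Fintype ι] (s : ι → Set Y) (t : ι → Y) :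
    (Set.univ.pi s).indicator (fun _ => (1 : ℂ)) t = ∏ j, (s j).indicator (fun _ => (1 : ℂ)) (t j) := by
  classical
  simp only [Set.indicator_apply, Set.mem_univ_pi]
  rw [Finset.prod_ite_zero]
  simp

/-- For boxes the integrand is a product over positions; grouping the positions by block separates
the variables. -/
lemma integral_prod_indicator_blocks (π : Finpartition (Finset.univ : Finset (Fin (∑ i, n i))))
    (s : Fin (∑ i, n i) → Set ℝ≥0) :
    ∫ u, ∏ i, (Set.univ.pi fun j : Fin (n i) => s (finSigmaFinEquiv ⟨i, j⟩)).indicator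
        (fun _ => (1 : ℂ)) (u ∘ blockOf π i) ∂(lebesguePosPi π.parts) =
      ∏ B ∈ π.parts, ∫ x, ∏ k ∈ B, (s k).indicator (fun _ => (1 : ℂ)) x ∂lebesguePos := by
  rw [← Finset.prod_coe_sort π.parts, ← integral_fintype_prod_eq_prod]
  refine integral_congr_ae (Eventually.of_forall fun u => ?_)
  simp only [indicator_univ_pi_one, Function.comp_apply]
  have h1 := Fintype.prod_sigma fun x : (i : Fin r) × Fin (n i) =>
    (s (finSigmaFinEquiv x)).indicator (fun _ => (1 : ℂ)) (u (blockOf π x.1 x.2))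
  rw [← h1]
  have h2 := Equiv.prod_comp finSigmaFinEquiv fun k : Fin (∑ i, n i) =>
    (s k).indicator (fun _ => (1 : ℂ)) (u ⟨π.part k, π.part_mem.2 (Finset.mem_univ k)⟩)
  refine h2.trans ?_
  rw [← Finset.prod_fiberwise Finset.univ
    (fun k => (⟨π.part k, π.part_mem.2 (Finset.mem_univ k)⟩ : π.parts))]
  refine Finset.prod_congr rfl fun B _ => ?_
  have h3 : (Finset.univ.filter fun k =>
      (⟨π.part k, π.part_mem.2 (Finset.mem_univ k)⟩ : π.parts) = B) = B.1 := by
    ext k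
    simp only [Finset.mem_filter, Finset.mem_univ, true_and]
    rw [Subtype.ext_iff]
    exact π.part_eq_iff_mem B.2
  rw [h3]
  refine Finset.prod_congr rfl fun k hk => ?_
  congr 2
  exact Subtype.ext (π.part_eq_of_mem B.2 hk)

/-- The sum over all respectful noncrossing pairings of the contractions. -/
def contractionSum (n : Fin r → ℕ) :
    ContinuousMultilinearMap ℂ (fun i => Lp ℂ 2 (lebesguePosPi (Fin (n i)))) ℂ :=
  ∑ π : respectfulNCPairings n, contraction lebesguePos (e := blockOf π.1)
    (blockOf_injective (mem_respectfulNCPairings.1 π.2).2.2)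
    (card_mem_range_blockOf (mem_respectfulNCPairings.1 π.2).1
      (mem_respectfulNCPairings.1 π.2).2.2)

lemma contractionSum_eq {F : ∀ i, Lp ℂ 2 (lebesguePosPi (Fin (n i)))}
    {f : ∀ i, (Fin (n i) → ℝ≥0) → ℂ} (h : ∀ i, F i =ᵐ[lebesguePosPi (Fin (n i))] f i) :
    contractionSum n F = ∑ π ∈ respectfulNCPairings n, pairingIntegral π (tensorFun f) := by
  rw [contractionSum, sum_apply,
    ← Finset.sum_coe_sort (respectfulNCPairings n)]
  refine Finset.sum_congr rfl fun π _ => ?_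
  rw [contraction_apply]
  exact integral_prod_comp_congr (blockOf_injective (mem_respectfulNCPairings.1 π.2).2.2) h

lemma norm_contractionSum_le (F : ∀ i, Lp ℂ 2 (lebesguePosPi (Fin (n i)))) :
    ‖contractionSum n F‖ ≤ 2 ^ (∑ i, n i) * ∏ i, ‖F i‖ := by
  rw [contractionSum, sum_apply]
  refine (norm_sum_le_of_le _ fun π _ => norm_contraction_le _ _ F).trans ?_
  rw [Finset.sum_const, nsmul_eq_mul]
  gcongr
  simpa using (Nat.cast_le (α := ℝ)).2 (card_respectfulNCPairings_le n)

end Pairings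

/-! ### The moment formula for step functions and its extension to `L²`. -/

section FreeProbability

variable {H : Type*} [NormedAddCommGroup H] [InnerProductSpace ℂ H] [CompleteSpace H]
  {P : WStarProbabilitySpace H} {S : ℝ≥0 → P.Elem}

lemma integral_prod_indicator_eq_zero {α : Type*} {s : α → Set ℝ≥0} {B : Finset α}
    {x y : α} (hx : x ∈ B) (hy : y ∈ B) (hd : Disjoint (s x) (s y)) :
    ∫ t, ∏ k ∈ B, (s k).indicator (fun _ => (1 : ℂ)) t ∂lebesguePos = 0 := by
  refine integral_eq_zero_of_ae (Eventually.of_forall fun t => ?_)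
  by_cases ht : t ∈ s x
  · exact Finset.prod_eq_zero hy (Set.indicator_of_notMem (Set.disjoint_left.1 hd ht) _)
  · exact Finset.prod_eq_zero hx (Set.indicator_of_notMem ht _)

lemma IsFreeBrownianMotion.map_prod_of_mem_wignerStepLp (hS : IsFreeBrownianMotion P S) {r : ℕ}
    {n : Fin r → ℕ} (m : ∀ i, Lp ℂ 2 (lebesguePosPi (Fin (n i))) × P.Elem)
    (hm : ∀ i, m i ∈ wignerStepLp P S (n i)) :
    P.φ (List.ofFn fun i => (m i).2).prod = contractionSum n fun i => (m i).1 := by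
  -- Both sides are multilinear in pairs of a function and an operator. Working on the graph allows
  -- comparison on boxes alone, before the operator is known to depend only on the function.
  let Ψ : MultilinearMap ℂ (fun i => Lp ℂ 2 (lebesguePosPi (Fin (n i))) × P.Elem) ℂ :=
    P.φ.compMultilinearMap ((MultilinearMap.mkPiAlgebraFin ℂ r P.Elem).compLinearMap
      fun i => LinearMap.snd ℂ (Lp ℂ 2 (lebesguePosPi (Fin (n i)))) P.Elem)
  let Θ : MultilinearMap ℂ (fun i => Lp ℂ 2 (lebesguePosPi (Fin (n i))) × P.Elem) ℂ :=
    (contractionSum n).toMultilinearMap.compLinearMap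
      fun i => LinearMap.fst ℂ (Lp ℂ 2 (lebesguePosPi (Fin (n i)))) P.Elem
  have e1 : ∀ m, Ψ m = P.φ (List.ofFn fun i => (m i).2).prod := fun m => by
    simp only [Ψ, LinearMap.compMultilinearMap_apply, MultilinearMap.compLinearMap_apply,
      MultilinearMap.mkPiAlgebraFin_apply, LinearMap.snd_apply]
  have e2 : ∀ m, Θ m = contractionSum n fun i => (m i).1 := fun m => by
    simp only [Θ, MultilinearMap.compLinearMap_apply, ContinuousMultilinearMap.coe_coe,
      LinearMap.fst_apply]
  rw [← e1, ← e2]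
  clear_value Ψ Θ
  refine MultilinearMap.eq_of_forall_mem_span (fun m hm => ?_) m hm
  choose a b hab hd h1 h2 using hm
  rw [e1, e2, contractionSum_eq h1]
  have hflat : ∀ c : ∀ i, Fin (n i) → ℝ≥0, ∃ C : Fin (∑ i, n i) → ℝ≥0,
      ∀ i j, C (finSigmaFinEquiv ⟨i, j⟩) = c i j := fun c =>
    ⟨fun k => c (finSigmaFinEquiv.symm k).1 (finSigmaFinEquiv.symm k).2, fun i j =>
      congrArg (fun p : (i : Fin r) × Fin (n i) => c p.1 p.2) (Equiv.symm_apply_apply _ _)⟩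
  obtain ⟨A, hA⟩ := hflat a
  obtain ⟨B, hB⟩ := hflat b
  have hAB : ∀ k, A k ≤ B k := fun k => by
    obtain ⟨⟨i, j⟩, rfl⟩ := finSigmaFinEquiv.surjective k
    rw [hA, hB]
    exact hab i j
  have e3 := List.prod_ofFn_finSigmaFinEquiv n fun k => S (B k) - S (A k)
  have e4 : (List.ofFn fun i => (m i).2) = List.ofFn fun i => (List.ofFn fun j : Fin (n i) =>
      S (B (finSigmaFinEquiv ⟨i, j⟩)) - S (A (finSigmaFinEquiv ⟨i, j⟩))).prod := by
    congr 1; funext i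
    simp only [h2 i, hA, hB]
  rw [e4, e3, hS.map_prod_increments A B hAB, ← sum_respectfulNCPairings n (fun C =>
    ∫ x, ∏ k ∈ C, (Set.Icc (A k) (B k)).indicator (fun _ => (1 : ℂ)) x ∂lebesguePos)]
  · refine Finset.sum_congr rfl fun π _ => ?_
    rw [← integral_prod_indicator_blocks π fun k => Set.Icc (A k) (B k), pairingIntegral,
      onBlocks_tensorFun]
    simp only [hA, hB]
  · rintro C ⟨x, hx, y, hy, hxy, hi⟩
    refine integral_prod_indicator_eq_zero hx hy ?_
    obtain ⟨⟨i, j⟩, rfl⟩ := finSigmaFinEquiv.surjective x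
    obtain ⟨⟨i', k⟩, rfl⟩ := finSigmaFinEquiv.surjective y
    simp only [Equiv.symm_apply_apply] at hi
    subst hi
    simp only [hA, hB]
    exact hd i j k (by rintro rfl; exact hxy rfl)

/-- The closure of the graph of the Wigner integral on off-diagonal step functions. -/
def wignerLp (P : WStarProbabilitySpace H) (S : ℝ≥0 → P.Elem) (n : ℕ) :
    Submodule ℂ (Lp ℂ 2 (lebesguePosPi (Fin n)) × P.Elem) :=
  (wignerStepLp P S n).topologicalClosure

/-- Both sides are continuous for the `L²` norm on functions and the operator norm on operators, so
the identity passes to the closure of the graph. -/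
lemma IsFreeBrownianMotion.map_prod_of_mem_wignerLp (hS : IsFreeBrownianMotion P S) {r : ℕ}
    {n : Fin r → ℕ} (m : ∀ i, Lp ℂ 2 (lebesguePosPi (Fin (n i))) × P.Elem)
    (hm : ∀ i, m i ∈ wignerLp P S (n i)) :
    P.φ (List.ofFn fun i => (m i).2).prod = contractionSum n fun i => (m i).1 := by
  have hclosed : IsClosed {m : ∀ i, Lp ℂ 2 (lebesguePosPi (Fin (n i))) × P.Elem |
      P.φ (List.ofFn fun i => (m i).2).prod = contractionSum n fun i => (m i).1} := by
    refine isClosed_eq (P.continuous_φ.comp ?_) ((contractionSum n).cont.comp (by fun_prop))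
    have h := (ContinuousMultilinearMap.mkPiAlgebraFin ℂ r P.Elem).cont.comp
      (f := fun m : ∀ i, Lp ℂ 2 (lebesguePosPi (Fin (n i))) × P.Elem => fun i => (m i).2)
      (by fun_prop)
    exact h
  have hcl : m ∈ closure (Set.univ.pi fun i =>
      (wignerStepLp P S (n i) : Set (Lp ℂ 2 (lebesguePosPi (Fin (n i))) × P.Elem))) := by
    rw [closure_pi_set]
    exact fun i _ => hm i
  refine closure_minimal (fun m hm => ?_) hclosed hcl
  exact hS.map_prod_of_mem_wignerStepLp m fun i => hm i trivial

/-- The adjoint reverses the order of the self-adjoint increments, so it is the integral of the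
conjugate function with reversed variables. -/
lemma IsFreeBrownianMotion.star_mem_wignerStepGraph (hS : IsFreeBrownianMotion P S) {n : ℕ}
    {q : ((Fin n → ℝ≥0) → ℂ) × P.Elem} (hq : q ∈ wignerStepGraph P S n) :
    ((fun t => star (q.1 (t ∘ Fin.rev)), star q.2) : ((Fin n → ℝ≥0) → ℂ) × P.Elem) ∈
      wignerStepGraph P S n := by
  induction hq using Submodule.span_induction with
  | mem q hq =>
    obtain ⟨a, b, hab, hd, h1, h2⟩ := hq
    refine Submodule.subset_span ⟨a ∘ Fin.rev, b ∘ Fin.rev, fun j => hab _,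
      fun j k hjk => hd _ _ (Fin.rev_injective.ne hjk), ?_, ?_⟩
    · funext t
      simp only [h1, indicator_univ_pi_one, Function.comp_apply, star_prod]
      rw [← Equiv.prod_comp Fin.revPerm]
      refine Finset.prod_congr rfl fun j _ => ?_
      simp [Set.indicator_apply, apply_ite]
    · simp only [h2, List.star_prod_ofFn, star_sub, (hS.selfAdjoint _).star_eq,
        Function.comp_apply]
  | zero => convert Submodule.zero_mem (wignerStepGraph P S n) using 1; ext <;> simp
  | add p q _ _ hp hq =>
    convert Submodule.add_mem _ hp hq using 1
    refine Prod.ext (funext fun t => ?_) ?_ <;> simp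
  | smul c p _ hp =>
    convert Submodule.smul_mem _ (star c) hp using 1
    refine Prod.ext (funext fun t => ?_) ?_ <;> simp

lemma eLpNorm_star_comp_rev {n : ℕ} {g : (Fin n → ℝ≥0) → ℂ}
    (hg : AEStronglyMeasurable g (lebesguePosPi (Fin n))) :
    eLpNorm (fun t => star (g (t ∘ Fin.rev))) 2 (lebesguePosPi (Fin n)) =
      eLpNorm g 2 (lebesguePosPi (Fin n)) := by
  have h1 : MeasurePreserving (fun t : Fin n → ℝ≥0 => t ∘ Fin.rev) (lebesguePosPi (Fin n))
      (lebesguePosPi (Fin n)) := by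
    convert measurePreserving_piCongrLeft (fun _ : Fin n => lebesguePos) Fin.revPerm using 1
    funext t j
    have := MeasurableEquiv.piCongrLeft_apply_apply (β := fun _ : Fin n => ℝ≥0) Fin.revPerm t
      (Fin.revPerm j)
    simpa using this.symm
  rw [← eLpNorm_comp_measurePreserving hg h1]
  exact eLpNorm_congr_norm_ae (Eventually.of_forall fun t => by simp)

lemma IsFreeBrownianMotion.norm_le_of_mem_wignerStepLp (hS : IsFreeBrownianMotion P S) {n : ℕ}
    {p : Lp ℂ 2 (lebesguePosPi (Fin n)) × P.Elem} (hp : p ∈ wignerStepLp P S n) :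
    ‖p.2‖ ≤ 2 ^ n * ‖p.1‖ := by
  obtain ⟨F', hF', hnorm⟩ : ∃ F' : Lp ℂ 2 (lebesguePosPi (Fin n)),
      (F', star p.2) ∈ wignerStepLp P S n ∧ ‖F'‖ = ‖p.1‖ := by
    obtain ⟨g, hg, hgp⟩ := exists_mem_wignerStepGraph hp
    obtain ⟨F', hF', hF'g⟩ := exists_mem_wignerStepLp (hS.star_mem_wignerStepGraph hg)
    refine ⟨F', hF', ?_⟩
    rw [Lp.norm_def, Lp.norm_def, eLpNorm_congr_ae hF'g, eLpNorm_congr_ae hgp,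
      eLpNorm_star_comp_rev ((Lp.aestronglyMeasurable p.1).congr hgp)]
  refine abs_le_of_sq_le_sq' ?_ (by positivity) |>.2
  refine P.norm_sq_le_of_moments p.2 1 _ (fun m => ?_) (by positivity)
  -- The `m`-th moment of `X* X` is a product of `2 * m` step integrals. The bound `2 ^ (2 * m * n)`
  -- on the number of pairings yields the rate `(2 ^ n * ‖p.1‖) ^ 2` with constant one.
  have h := hS.map_prod_of_mem_wignerStepLp (r := m * 2) (n := fun _ => n)
    (fun i => if (i : ℕ) % 2 = 0 then (F', star p.2) else p)
    (fun i => by split_ifs <;> assumption)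
  simp only [apply_ite Prod.snd, apply_ite Prod.fst] at h
  rw [List.prod_ofFn_alternating] at h
  rw [h]
  refine (Complex.re_le_norm _).trans ((norm_contractionSum_le _).trans_eq ?_)
  simp only [apply_ite norm, hnorm, ite_self, Finset.prod_const, Finset.sum_const,
    Finset.card_univ, Fintype.card_fin, smul_eq_mul, one_mul]
  ring

lemma IsFreeBrownianMotion.norm_le_of_mem_wignerLp (hS : IsFreeBrownianMotion P S) {n : ℕ}
    {p : Lp ℂ 2 (lebesguePosPi (Fin n)) × P.Elem} (hp : p ∈ wignerLp P S n) :
    ‖p.2‖ ≤ 2 ^ n * ‖p.1‖ :=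
  closure_minimal (fun _ h => hS.norm_le_of_mem_wignerStepLp h)
    (isClosed_le (f := fun p : Lp ℂ 2 (lebesguePosPi (Fin n)) × P.Elem => ‖p.2‖)
      (g := fun p => 2 ^ n * ‖p.1‖) (by fun_prop) (by fun_prop)) hp

/-- The norm bound makes the integrals of an approximating sequence of step functions Cauchy in
operator norm, so the limit is an element of the algebra. -/
lemma IsFreeBrownianMotion.exists_mem_wignerLp (hS : IsFreeBrownianMotion P S) {n : ℕ}
    (F : Lp ℂ 2 (lebesguePosPi (Fin n))) : ∃ X, (F, X) ∈ wignerLp P S n := by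
  have hF : F ∈ closure
      (((wignerStepLp P S n).map (LinearMap.fst ℂ _ _) : Submodule ℂ _) : Set _) := by
    rw [← Submodule.topologicalClosure_coe, topologicalClosure_map_fst_wignerStepLp]
    trivial
  obtain ⟨G, hG, hlim⟩ := mem_closure_iff_seq_limit.1 hF
  choose p hp hpG using fun k => Submodule.mem_map.1 (hG k)
  have hpG' : ∀ k, (p k).1 = G k := hpG
  have hcauchy : CauchySeq fun k => (p k).2 := by
    refine Metric.cauchySeq_iff.2 fun ε hε => ?_
    obtain ⟨N, hN⟩ := Metric.cauchySeq_iff.1 hlim.cauchySeq (ε / 2 ^ n) (by positivity)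
    refine ⟨N, fun k hk l hl => ?_⟩
    have h1 := hS.norm_le_of_mem_wignerStepLp (Submodule.sub_mem _ (hp k) (hp l))
    have h2 := hN k hk l hl
    rw [dist_eq_norm, lt_div_iff₀ (by positivity)] at h2
    rw [Prod.snd_sub, Prod.fst_sub, hpG', hpG'] at h1
    rw [dist_eq_norm]
    linarith
  obtain ⟨X, hX⟩ := cauchySeq_tendsto_of_complete hcauchy
  refine ⟨X, mem_closure_of_tendsto (hlim.prodMk_nhds hX) (Eventually.of_forall fun k => ?_)⟩
  rw [← hpG' k]
  exact hp k

lemma IsFreeBrownianMotion.isWignerIntegral_of_mem_wignerLp {n : ℕ}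
    {f : (Fin n → ℝ≥0) → ℂ} (hf : MemLp f 2 (lebesguePosPi (Fin n))) {X : P.Elem}
    (hX : (hf.toLp f, X) ∈ wignerLp P S n) : IsWignerIntegral P S f X := by
  obtain ⟨p, hp, hlim⟩ := mem_closure_iff_seq_limit.1 hX
  choose g hg hgp using fun k => exists_mem_wignerStepGraph (hp k)
  refine ⟨g, fun k => (p k).2, hg, ?_, ?_⟩
  · have h1 : Tendsto (fun k => (p k).1) atTop (𝓝 (hf.toLp f)) :=
      (continuous_fst.tendsto _).comp hlim
    rw [Lp.tendsto_Lp_iff_tendsto_eLpNorm'] at h1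
    refine h1.congr fun k => eLpNorm_congr_ae ((hgp k).sub hf.coeFn_toLp)
  · have h1 : Tendsto (fun k => (p k).2) atTop (𝓝 X) := (continuous_snd.tendsto _).comp hlim
    have hc : Continuous fun Y : P.Elem => P.φ (star (Y - X) * (Y - X)) :=
      P.continuous_φ.comp (by fun_prop)
    have h2 := (hc.tendsto X).comp h1
    simpa [Function.comp_def] using h2

/-- Convergence in the weaker norm of `φ` allows no other limit: by the norm bound the approximating
integrals converge to `X` even in operator norm, and `φ` is faithful. -/
lemma IsFreeBrownianMotion.eq_of_isWignerIntegral (hS : IsFreeBrownianMotion P S) {n : ℕ}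
    {f : (Fin n → ℝ≥0) → ℂ} (hf : MemLp f 2 (lebesguePosPi (Fin n))) {X Z : P.Elem}
    (hX : (hf.toLp f, X) ∈ wignerLp P S n) (hZ : IsWignerIntegral P S f Z) : Z = X := by
  obtain ⟨g, Y, hg, hlim, hY⟩ := hZ
  choose F hF hFg using fun k => exists_mem_wignerStepLp (hg k)
  have hFlim : Tendsto F atTop (𝓝 (hf.toLp f)) := by
    rw [Lp.tendsto_Lp_iff_tendsto_eLpNorm']
    exact hlim.congr fun k => (eLpNorm_congr_ae ((hFg k).sub hf.coeFn_toLp)).symm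
  have hYX : Tendsto (fun k => Y k - X) atTop (𝓝 0) := by
    refine squeeze_zero_norm (a := fun k => 2 ^ n * ‖F k - hf.toLp f‖) (fun k => ?_) ?_
    · have h1 : (F k, Y k) ∈ wignerLp P S n := Submodule.le_topologicalClosure _ (hF k)
      have h2 := hS.norm_le_of_mem_wignerLp (Submodule.sub_mem _ h1 hX)
      rwa [Prod.mk_sub_mk] at h2
    · simpa using (tendsto_iff_norm_sub_tendsto_zero.1 hFlim).const_mul (2 ^ n)
  have hc : Continuous fun V : P.Elem => P.φ (star V * V) := P.continuous_φ.comp (by fun_prop)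
  have h1 : Tendsto (fun k => P.φ (star (Y k - X) * (Y k - X))) atTop (𝓝 0) := by
    simpa [Function.comp_def] using (hc.tendsto 0).comp hYX
  have hre : ∀ {u : ℕ → ℂ}, Tendsto u atTop (𝓝 0) → Tendsto (fun k => (u k).re) atTop (𝓝 0) :=
    fun h => (Complex.continuous_re.tendsto 0).comp h
  have h2 : (P.φ (star (Z - X) * (Z - X))).re ≤ 2 * 0 + 2 * 0 :=
    ge_of_tendsto' (((hre hY).const_mul 2).add ((hre h1).const_mul 2))
      fun k => P.re_φ_star_mul_self_sub_le Z (Y k) X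
  have h3 : P.φ (star (Z - X) * (Z - X)) = 0 :=
    Complex.ext (le_antisymm (by simpa using h2) (P.re_φ_star_mul_self_nonneg _))
      (P.im_φ_star_mul_self _)
  have h4 := P.faithful (star (Z - X)) (by rwa [star_star])
  exact sub_eq_zero.1 (star_eq_zero.1 h4)

end FreeProbability

end

theorem mainTheorem10 {H : Type*} [NormedAddCommGroup H] [InnerProductSpace ℂ H]
    [CompleteSpace H] (P : WStarProbabilitySpace H) (S : ℝ≥0 → P.Elem)
    (hS : IsFreeBrownianMotion P S) {r : ℕ} (n : Fin r → ℕ) (hn : ∀ i, 0 < n i)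
    (f : ∀ i, (Fin (n i) → ℝ≥0) → ℂ)
    (hf : ∀ i, MemLp (f i) 2 (lebesguePosPi (Fin (n i)))) :
    (∀ i, ∃! X : P.Elem, IsWignerIntegral P S (f i) X) ∧
    (∀ π ∈ respectfulNCPairings n,
      Integrable (onBlocks π (tensorFun f)) (lebesguePosPi π.parts)) ∧
    P.φ (List.ofFn fun i => wignerIntegral P S (f i)).prod =
      ∑ π ∈ respectfulNCPairings n, pairingIntegral π (tensorFun f) := by
  choose X hX using fun i => hS.exists_mem_wignerLp ((hf i).toLp (f i))
  have hW : ∀ i, IsWignerIntegral P S (f i) (X i) := fun i =>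
    IsFreeBrownianMotion.isWignerIntegral_of_mem_wignerLp (hf i) (hX i)
  refine ⟨fun i => ⟨X i, hW i, fun Z hZ => hS.eq_of_isWignerIntegral (hf i) (hX i) hZ⟩,
    fun π hπ => ?_, ?_⟩
  · obtain ⟨h1, -, h2⟩ := mem_respectfulNCPairings.1 hπ
    exact integrable_prod_comp (blockOf_injective h2) (card_mem_range_blockOf h1 h2) hf
  · have hI : ∀ i, wignerIntegral P S (f i) = X i := fun i => by
      have hex : ∃ X, IsWignerIntegral P S (f i) X := ⟨X i, hW i⟩
      rw [wignerIntegral, dif_pos hex]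
      exact hS.eq_of_isWignerIntegral (hf i) (hX i) hex.choose_spec
    simp only [hI]
    rw [← contractionSum_eq fun i => (hf i).coeFn_toLp]
    exact hS.map_prod_of_mem_wignerLp (fun i => ((hf i).toLp (f i), X i)) hX
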